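/- Let $N\ge 2$ and let $\Omega\subset\mathbb{R}^N$ be a bounded domain with boundary $\Gamma$ of class $C^2$ (near each of its points $\Gamma$ is the regular zero level set of a $C^2$ function that is negative exactly on $\Omega$). Let $\nu$ be the exterior unit normal field on $\Gamma$, and let $\nabla\nu$ be its Jacobian on $\Gamma$, that is, the symmetric linear map which is the differential of $\nu$ along $\Gamma$ on tangent vectors and which satisfies $(\nabla\nu)\,\nu=0$ (equivalently, the Jacobian on $\Gamma$ of the extension of $\nu$ by $-\nabla\,\mathrm{dist}(\cdot,\Gamma)$ in $\overline\Omega$ near $\Gamma$). Let $$H=\frac{1}{N-1}\sum_{j=1}^{N-1}\kappa_j$$ be the mean curvature of $\Gamma$, where the principal curvatures $\kappa_1,\dots,\kappa_{N-1}$ with respect to the interior normal are the eigenvalues of $\nabla\nu$ on the tangent space (positive if $\Omega$ is a ball). For $v\in C^2(\overline\Omega)$ write $v_\nu=\langle\nabla v,\nu\rangle$ and $\nabla_\Gamma v=\nabla v-v_\nu\,\nu$ on $\Gamma$. Let $dS_x$ be the surface measure on $\Gamma$. Let $u\in C^2(\overline\Omega)$ satisfy $\Delta u=N$ in $\Omega$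 and $u_\nu=R$ on $\Gamma$ for a constant $R\in\mathbb{R}$ (necessarily $R=N|\Omega|/|\Gamma|$), and put $\overline u=\max_{\overline\Omega}u$. Let $q(x)=\frac12|x-z|^2+a$ with $z\in\mathbb{R}^N$ and $a\in\mathbb{R}$, and set $h=q-u$. Then all the integrands below are integrable and $$\int_\Omega(\overline u-u)\,|\nabla^2h|^2\,dx=\frac12\int_\Gamma|\nabla_\Gamma u|^2\,h_\nu\,dS_x+\int_\Gamma(\overline u-u)\bigl[(N-1)RH-N\bigr]h_\nu\,dS_x-\int_\Gamma(\overline u-u)\,\bigl\langle(\nabla\nu)\nabla_\Gamma u,\nabla_\Gamma u\bigr\rangle\,dS_x,$$ where $|\nabla^2h|^2$ is the sum of the squares of all second order partial derivatives of $h$. -/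

import Mathlib

open MeasureTheory Filter Topology
open scoped RealInnerProductSpace Laplacian

noncomputable section

namespace NeumannIdentity

/-- `Ω` has boundary of class `C²`: near each boundary point, `Ω` is the sublevel set `{φ < 0}` of a
function `φ` which is twice continuously differentiable around the point and has non-zero derivative
there (so that the boundary is locally the regular level set `{φ = 0}`). -/
def HasC2Boundary {N : ℕ} (Ω : Set (EuclideanSpace ℝ (Fin N))) : Prop :=
  ∀ x ∈ frontier Ω, ∃ φ : EuclideanSpace ℝ (Fin N) → ℝ,
    ContDiffAt ℝ 2 φ x ∧ fderiv ℝ φ x ≠ 0 ∧ ∀ᶠ y in 𝓝 x, (y ∈ Ω ↔ φ y < 0)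

/-- `n` is the exterior unit normal of `Ω` at `x`: a unit vector such that every direction which makes
an obtuse angle with `n` points into `Ω`, and every direction which makes an acute angle with `n`
points into the exterior of `Ω`. -/
def IsExteriorUnitNormal {N : ℕ} (Ω : Set (EuclideanSpace ℝ (Fin N)))
    (x n : EuclideanSpace ℝ (Fin N)) : Prop :=
  ‖n‖ = 1 ∧
    (∀ v, ⟪v, n⟫ < 0 → ∀ᶠ t : ℝ in 𝓝[>] 0, x + t • v ∈ Ω) ∧
    (∀ v, 0 < ⟪v, n⟫ → ∀ᶠ t : ℝ in 𝓝[>] 0, x + t • v ∉ closure Ω)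

theorem IsExteriorUnitNormal.unique {N : ℕ} {Ω : Set (EuclideanSpace ℝ (Fin N))}
    {x n m : EuclideanSpace ℝ (Fin N)} (hn : IsExteriorUnitNormal Ω x n)
    (hm : IsExteriorUnitNormal Ω x m) : n = m := by
  by_contra hne
  have hlt : ⟪m, n⟫ < 1 := by
    rw [inner_lt_one_iff_real_of_norm_eq_one hm.1 hn.1]
    exact fun h => hne h.symm
  have h1 : ⟪m - n, n⟫ < 0 := by
    rw [inner_sub_left, real_inner_self_eq_norm_sq, hn.1]; linarith
  have h2 : 0 < ⟪m - n, m⟫ := by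
    rw [inner_sub_left, real_inner_self_eq_norm_sq, hm.1, real_inner_comm]; linarith
  obtain ⟨t, ht1, ht2⟩ := ((hn.2.1 _ h1).and (hm.2.2 _ h2)).exists
  exact ht2 (subset_closure ht1)

open Classical in
/-- The exterior unit normal field `ν` on the boundary of `Ω` (zero at points without a normal). -/
def extNormal {N : ℕ} (Ω : Set (EuclideanSpace ℝ (Fin N))) (x : EuclideanSpace ℝ (Fin N)) :
    EuclideanSpace ℝ (Fin N) :=
  if h : ∃ n, IsExteriorUnitNormal Ω x n then h.choose else 0

theorem IsExteriorUnitNormal.extNormal_eq {N : ℕ} {Ω : Set (EuclideanSpace ℝ (Fin N))}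
    {x n : EuclideanSpace ℝ (Fin N)} (hn : IsExteriorUnitNormal Ω x n) : extNormal Ω x = n := by
  have h : ∃ n, IsExteriorUnitNormal Ω x n := ⟨n, hn⟩
  rw [extNormal, dif_pos h]
  exact h.choose_spec.unique hn

/-- The normal derivative `v_ν = ⟨∇v, ν⟩` at a boundary point of `Ω`. The gradient at the boundary is
the one-sided gradient, relative to the closure of `Ω`. -/
def normalDeriv {N : ℕ} (Ω : Set (EuclideanSpace ℝ (Fin N))) (v : EuclideanSpace ℝ (Fin N) → ℝ)
    (x : EuclideanSpace ℝ (Fin N)) : ℝ :=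
  ⟪gradientWithin v (closure Ω) x, extNormal Ω x⟫

/-- The tangential gradient `∇_Γ v = ∇v - v_ν ν` at a boundary point of `Ω`. -/
def tangentialGradient {N : ℕ} (Ω : Set (EuclideanSpace ℝ (Fin N)))
    (v : EuclideanSpace ℝ (Fin N) → ℝ) (x : EuclideanSpace ℝ (Fin N)) :
    EuclideanSpace ℝ (Fin N) :=
  gradientWithin v (closure Ω) x - normalDeriv Ω v x • extNormal Ω x

/-- The orthogonal projection `w ↦ w - ⟨ν, w⟩ ν` onto the tangent space of the boundary at `x`. -/
def tangentProj {N : ℕ} (Ω : Set (EuclideanSpace ℝ (Fin N))) (x : EuclideanSpace ℝ (Fin N)) :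
    EuclideanSpace ℝ (Fin N) →L[ℝ] EuclideanSpace ℝ (Fin N) :=
  ContinuousLinearMap.id ℝ _ - (innerSL ℝ (extNormal Ω x)).smulRight (extNormal Ω x)

/-- The Jacobian `∇ν` at a boundary point, as an endomorphism of the whole space: on the tangent space
of `Γ = frontier Ω` it is the differential of `ν` along `Γ`, and `(∇ν) ν = 0`. This is the Jacobian of
the extension of `ν` by minus the gradient of the distance to `Γ`. The derivative within `Γ` is
evaluated on tangent vectors of `Γ` only, where it is uniquely determined by `ν` on `Γ`. -/
def normalJacobian {N : ℕ} (Ω : Set (EuclideanSpace ℝ (Fin N))) (x : EuclideanSpace ℝ (Fin N)) :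
    EuclideanSpace ℝ (Fin N) →L[ℝ] EuclideanSpace ℝ (Fin N) :=
  tangentProj Ω x ∘L fderivWithin ℝ (extNormal Ω) (frontier Ω) x ∘L tangentProj Ω x

/-- The mean curvature `H = (κ₁ + ⋯ + κ_{N-1}) / (N - 1)` of the boundary, where the principal
curvatures `κ_j` with respect to the interior normal are the eigenvalues of `∇ν` on the tangent space
(so they are positive for a ball). Since `(∇ν) ν = 0`, their sum is the trace of `∇ν`. -/
def meanCurvature {N : ℕ} (Ω : Set (EuclideanSpace ℝ (Fin N))) (x : EuclideanSpace ℝ (Fin N)) : ℝ :=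
  LinearMap.trace ℝ (EuclideanSpace ℝ (Fin N)) (normalJacobian Ω x).toLinearMap / ((N : ℝ) - 1)

/-- `|∇²v|²`, the sum of the squares of all second order partial derivatives of `v` at `x`. -/
def hessianNormSq {N : ℕ} (v : EuclideanSpace ℝ (Fin N) → ℝ) (x : EuclideanSpace ℝ (Fin N)) : ℝ :=
  ∑ i : Fin N, ∑ j : Fin N,
    (iteratedFDeriv ℝ 2 v x ![EuclideanSpace.single i 1, EuclideanSpace.single j 1]) ^ 2

/-- The surface measure of the boundary: the `(N-1)`-dimensional Hausdorff measure, normalised so as to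
agree with Lebesgue measure on `(N-1)`-dimensional Euclidean space, restricted to `frontier Ω`. -/
def surfaceMeasure {N : ℕ} (Ω : Set (EuclideanSpace ℝ (Fin N))) :
    Measure (EuclideanSpace ℝ (Fin N)) :=
  (Measure.euclideanHausdorffMeasure (N - 1)).restrict (frontier Ω)

end NeumannIdentity

end

open NeumannIdentity

/-!
The identity is a Rellich-Pohozaev type integration by parts. The classical computation uses vector
fields built from second derivatives of `u`, whose divergences formally contain third derivatives
that cancel. As `u` is only `C²` up to the boundary, the cancellation has to be built into the
divergence theorem, which moreover has to be proved for the Hausdorff measure on the boundary.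

**Divergence theorem.** If a piece of the boundary is a graph over the hyperplane orthogonal to a
unit vector `m`, the projection along `m` pushes `⟪m, ν⟫ dS` forward to Lebesgue measure on the
shadow of the piece (`map_hyperplaneProj_surface`): near each point the piece is almost flat, so the
projection is almost a linear map with Jacobian `⟪m, ν⟫`, and two measures which are locally
comparable up to every factor `K > 1` are equal. Together with Fubini's theorem and the fundamental
theorem of calculus on lines this gives the divergence theorem in the direction `m`, for functions
which are differentiable in this direction only (`IsAdaptedBox.integral_lineDeriv`).

**Green's identity for `C¹` functions.** For `a, b` of class `C¹` up to the boundary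
`∫_Ω (∂ᵥa ∂_w b - ∂_w a ∂ᵥb) = ∫_Γ a (∂_w b ⟪v, ν⟫ - ∂ᵥb ⟪w, ν⟫)` (`integral_dirDeriv_mul_sub_eq`).
For smooth `b` this is the divergence theorem and `∂ᵥ∂_w b = ∂_w∂ᵥb`. For `b` of class `C¹` the
derivatives of `b` are replaced by their averages over short segments in the direction `-w`, which
stay in `Ω` near the support of `a` when `w` points outwards: the average of `∂_w b` is a difference
quotient of `b` and the average of `∂ᵥb` is differentiable in the direction `w`, so that the mixed
derivatives exist and agree. General directions follow by bilinearity, and general `a` by a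
partition of unity.

**Flux identity.** Summed over the coordinates, this says that the integral of
`tr (DX DY) - tr DX tr DY` over `Ω` is the flux of `(DY) X - (tr DY) X`, for `C¹` vector fields
`X`, `Y` (`isFluxPair_jacobian`). It contains the divergence theorem (`Y x = x`), and, the
left hand side being symmetric in `X` and `Y`, an integration by parts formula on the boundary
(`isFluxPair_antisymm`).

**The identity.** It is applied to combinations of `f = ubar - u`, `G = ∇u`, the field
`W = ∇h = x - z - G`, which has divergence zero, and a `C¹` extension `n` of the normal. The
combination in `isFluxPair_combination` has bulk density `f |∇²h|²`, and its boundary density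
involves the second derivatives `A` of `u` only through `⟪A (G - R ν), ν⟫`, where `G - R ν = ∇_Γ u`
is tangential. Differentiating `|ν|² = 1` and `⟪G, ν⟫ = R` in tangential directions expresses it by
the curvature (`boundary_density_eq`).
-/

/-! ### Linear projections along a line -/

section ProjectionArea

variable {V : Type*} [NormedAddCommGroup V] [InnerProductSpace ℝ V]

/-- The orthogonal projection along the line `ℝ m`, onto the hyperplane orthogonal to `m`. -/
noncomputable abbrev hyperplaneProj (m : V) : V →L[ℝ] (ℝ ∙ m)ᗮ :=
  (ℝ ∙ m)ᗮ.orthogonalProjectionOnto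

theorem coe_hyperplaneProj {m : V} (hm : ‖m‖ = 1) (x : V) :
    (hyperplaneProj m x : V) = x - ⟪m, x⟫ • m := by
  rw [Submodule.coe_orthogonalProjectionOnto_apply, Submodule.starProjection_orthogonal_val,
    Submodule.starProjection_unit_singleton ℝ hm]

/-- The linear map which lifts a vector orthogonal to `m`, in the direction of `m`, to the
hyperplane orthogonal to `ν`. -/
noncomputable def obliqueLift (m ν : V) : (ℝ ∙ m)ᗮ →ₗ[ℝ] V :=
  (ℝ ∙ m)ᗮ.subtype - ((⟪m, ν⟫⁻¹ • innerₛₗ ℝ ν) ∘ₗ (ℝ ∙ m)ᗮ.subtype).smulRight m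

theorem obliqueLift_apply (m ν : V) (x : (ℝ ∙ m)ᗮ) :
    obliqueLift m ν x = (x : V) - (⟪m, ν⟫⁻¹ * ⟪ν, (x : V)⟫) • m := by
  simp [obliqueLift]

theorem obliqueLift_hyperplaneProj {m ν : V} (hm : ‖m‖ = 1) (h : ⟪m, ν⟫ ≠ 0) (w : V) :
    obliqueLift m ν (hyperplaneProj m w) = w - (⟪m, ν⟫⁻¹ * ⟪ν, w⟫) • m := by
  rw [obliqueLift_apply, coe_hyperplaneProj hm, inner_sub_right, inner_smul_right,
    real_inner_comm m ν, sub_sub, ← add_smul]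
  congr 2
  field_simp
  ring

/-- The Jacobian determinant of the oblique lift: `Lᵀ L` is a transvection, of determinant
`1 + |proj ν|² / ⟪m, ν⟫² = ⟪m, ν⟫⁻²`. -/
theorem normDet_obliqueLift [FiniteDimensional ℝ V] {m ν : V} (hm : ‖m‖ = 1) (hν : ‖ν‖ = 1)
    (h : 0 < ⟪m, ν⟫) :
    (obliqueLift m ν).normDet = ⟪m, ν⟫⁻¹ := by
  have horth : ∀ x : (ℝ ∙ m)ᗮ, ⟪(x : V), m⟫ = 0 := fun x =>
    Submodule.mem_orthogonal_singleton_iff_inner_left.1 x.2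
  set ℓ : Module.Dual ℝ (ℝ ∙ m)ᗮ := (⟪m, ν⟫⁻¹ • innerₛₗ ℝ ν) ∘ₗ (ℝ ∙ m)ᗮ.subtype with hℓ
  have hℓa : ∀ x, ℓ x = ⟪m, ν⟫⁻¹ * ⟪ν, (x : V)⟫ := fun x => by simp [hℓ]
  set w : (ℝ ∙ m)ᗮ := ⟪m, ν⟫⁻¹ • hyperplaneProj m ν with hw
  have hwx : ∀ x : (ℝ ∙ m)ᗮ, ⟪w, x⟫ = ℓ x := by
    intro x
    rw [hℓa, hw, inner_smul_left, Submodule.coe_inner, coe_hyperplaneProj hm, inner_sub_left,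
      inner_smul_left, real_inner_comm, real_inner_comm _ m, horth, real_inner_comm]
    simp
  have hcomp : (obliqueLift m ν).adjoint ∘ₗ obliqueLift m ν = LinearMap.transvection ℓ w := by
    refine LinearMap.ext fun x => ?_
    refine ext_inner_right ℝ fun y => ?_
    rw [LinearMap.comp_apply, LinearMap.adjoint_inner_left, LinearMap.transvection.apply,
      inner_add_left, inner_smul_left, hwx, obliqueLift_apply, obliqueLift_apply, ← hℓa, ← hℓa]
    simp only [inner_sub_left, inner_sub_right, inner_smul_left, inner_smul_right, horth,
      real_inner_self_eq_norm_sq, hm, Submodule.coe_inner]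
    have h3 : ⟪m, (y : V)⟫ = 0 := by rw [real_inner_comm, horth]
    simp only [h3, conj_trivial]
    ring
  have hsq := (obliqueLift m ν).normDet_sq
  rw [hcomp, LinearMap.transvection.det] at hsq
  have hval : 1 + ℓ w = ⟪m, ν⟫⁻¹ ^ 2 := by
    rw [hℓa, hw]
    simp only [Submodule.coe_smul, coe_hyperplaneProj hm, inner_smul_right, inner_sub_right,
      real_inner_self_eq_norm_sq, hν, real_inner_comm m ν]
    field_simp
    ring
  rw [hval] at hsq
  simp only [RCLike.ofReal_real_eq_id, id_eq] at hsq
  exact (pow_left_inj₀ (LinearMap.normDet_nonneg _) (inv_nonneg.2 h.le) two_ne_zero).1 hsq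

end ProjectionArea

/-! ### Comparison of measures -/

section MeasureComparison

/-- Domination between measures is a local property. -/
theorem MeasureTheory.Measure.le_of_locally_le {X : Type*} [TopologicalSpace X]
    [SecondCountableTopology X] [MeasurableSpace X] [OpensMeasurableSpace X] {μ ν : Measure X}
    (h : ∀ x, ∃ W ∈ 𝓝 x, ∀ A ⊆ W, MeasurableSet A → μ A ≤ ν A) : μ ≤ ν := by
  choose W hW hle using h
  obtain ⟨s, hs, hcov⟩ := TopologicalSpace.countable_cover_nhds (fun x => interior_mem_nhds.2 (hW x))
  rcases s.eq_empty_or_nonempty with rfl | hne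
  · refine Measure.le_iff.2 fun A _ => ?_
    have : A = ∅ := by
      rw [Set.eq_empty_iff_forall_notMem]
      intro x
      have : x ∈ (Set.univ : Set X) := trivial
      rw [← hcov] at this
      simp at this
    simp [this]
  obtain ⟨e, rfl⟩ := hs.exists_eq_range hne
  refine Measure.le_iff.2 fun A hA => ?_
  set B : ℕ → Set X := disjointed fun n => interior (W (e n)) with hB
  have hBm : ∀ n, MeasurableSet (B n) :=
    MeasurableSet.disjointed fun n => isOpen_interior.measurableSet
  have hcov' : A = ⋃ n, A ∩ B n := by
    rw [← Set.inter_iUnion, hB, iUnion_disjointed]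
    rw [Set.biUnion_range] at hcov
    rw [hcov, Set.inter_univ]
  have hd : Pairwise (Function.onFun Disjoint fun n => A ∩ B n) := fun i j hij =>
    (disjoint_disjointed _ hij).mono Set.inter_subset_right Set.inter_subset_right
  rw [hcov', measure_iUnion hd fun n => hA.inter (hBm n),
    measure_iUnion hd fun n => hA.inter (hBm n)]
  refine ENNReal.tsum_le_tsum fun n => hle (e n) _ ?_ (hA.inter (hBm n))
  exact Set.inter_subset_right.trans ((disjointed_subset _ n).trans interior_subset)

theorem ENNReal.le_of_forall_one_lt_le_mul {a b : ENNReal}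
    (h : ∀ K : NNReal, 1 < K → a ≤ K * b) : a ≤ b := by
  have ht : Tendsto (fun K : NNReal => (K : ENNReal) * b) (𝓝[>] 1) (𝓝 (1 * b)) := by
    refine ENNReal.Tendsto.mul_const ?_ (Or.inl one_ne_zero)
    exact (ENNReal.continuous_coe.tendsto 1).mono_left nhdsWithin_le_nhds
  rw [one_mul] at ht
  exact ge_of_tendsto ht (eventually_nhdsWithin_of_forall h)

open Measure in
theorem euclideanHausdorffMeasure_image_le_of_lipschitzOnWith {X Y : Type*} [MetricSpace X]
    [MetricSpace Y] [MeasurableSpace X] [BorelSpace X] [MeasurableSpace Y] [BorelSpace Y]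
    {K : NNReal} {f : X → Y} {s : Set X} (h : LipschitzOnWith K f s) (d : ℕ) :
    euclideanHausdorffMeasure d (f '' s) ≤ (K : ENNReal) ^ d * euclideanHausdorffMeasure d s := by
  simp_rw [euclideanHausdorffMeasure_def, Measure.smul_apply, ENNReal.smul_def, smul_eq_mul]
  rw [mul_left_comm]
  gcongr
  have := h.hausdorffMeasure_image_le (d := d) (by positivity)
  rwa [ENNReal.rpow_natCast] at this

open Measure in
/-- A map which does not shrink distances on `s` by more than the factor `K` does not shrink the
Hausdorff measure of `s` by more than the factor `K ^ d`. -/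
theorem le_euclideanHausdorffMeasure_image {X Y : Type*} [MetricSpace X]
    [MetricSpace Y] [MeasurableSpace X] [BorelSpace X] [MeasurableSpace Y] [BorelSpace Y]
    {K : NNReal} {f : X → Y} {s : Set X} (h : ∀ x ∈ s, ∀ y ∈ s, dist x y ≤ K * dist (f x) (f y))
    (d : ℕ) :
    euclideanHausdorffMeasure d s ≤ (K : ENNReal) ^ d * euclideanHausdorffMeasure d (f '' s) := by
  have hinj : Set.InjOn f s := fun x hx y hy hxy => by
    have := h x hx y hy
    rw [hxy, dist_self, mul_zero] at this
    exact dist_le_zero.1 this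
  rcases s.eq_empty_or_nonempty with rfl | ⟨x₀, -⟩
  · simp
  have : Nonempty X := ⟨x₀⟩
  have hl : LipschitzOnWith K (Function.invFunOn f s) (f '' s) := by
    refine LipschitzOnWith.of_dist_le_mul ?_
    rintro _ ⟨x, hx, rfl⟩ _ ⟨y, hy, rfl⟩
    rw [hinj.leftInvOn_invFunOn hx, hinj.leftInvOn_invFunOn hy]
    exact h x hx y hy
  have := euclideanHausdorffMeasure_image_le_of_lipschitzOnWith hl d
  rwa [hinj.leftInvOn_invFunOn.image_image] at this

end MeasureComparison

/-! ### The area formula for a projection -/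

section AreaFormula

variable {V : Type*} [NormedAddCommGroup V] [InnerProductSpace ℝ V] [FiniteDimensional ℝ V]
  [MeasurableSpace V] [BorelSpace V]

open Measure

/-- If `S` is tangent, up to the relative error `ε`, to the hyperplane orthogonal to `ν`, then the
projection along `m` scales the surface measure of `S` by a factor close to `⟪m, ν⟫`. -/
theorem volume_hyperplaneProj_image_approx {m ν : V} (hm : ‖m‖ = 1) (hν : ‖ν‖ = 1)
    (h : 0 < ⟪m, ν⟫) {ε : NNReal} (hε : ε < 1) {S : Set V}
    (hS : ∀ x ∈ S, ∀ y ∈ S, |⟪ν, x - y⟫| ≤ ε * ⟪m, ν⟫ * ‖x - y‖) :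
    volume (hyperplaneProj m '' S) ≤ ENNReal.ofReal ⟪m, ν⟫ * (((1 + ε : NNReal) : ENNReal) ^
        Module.finrank ℝ (ℝ ∙ m)ᗮ * euclideanHausdorffMeasure (Module.finrank ℝ (ℝ ∙ m)ᗮ) S) ∧
      ENNReal.ofReal ⟪m, ν⟫ * euclideanHausdorffMeasure (Module.finrank ℝ (ℝ ∙ m)ᗮ) S ≤
        (((1 - ε)⁻¹ : NNReal) : ENNReal) ^ Module.finrank ℝ (ℝ ∙ m)ᗮ *
          volume (hyperplaneProj m '' S) := by
  set d := Module.finrank ℝ (ℝ ∙ m)ᗮ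
  set p : V → V := fun w => obliqueLift m ν (hyperplaneProj m w) with hp
  have hvol : volume (hyperplaneProj m '' S) =
      ENNReal.ofReal ⟪m, ν⟫ * euclideanHausdorffMeasure d (p '' S) := by
    have := (obliqueLift m ν).euclideanHausdorffMeasure_image_eq_normDet_mul_volume
      (hyperplaneProj m '' S)
    rw [Set.image_image, normDet_obliqueLift hm hν h] at this
    rw [this, ← mul_assoc, ← ENNReal.ofReal_mul h.le, mul_inv_cancel₀ h.ne', ENNReal.ofReal_one,
      one_mul]
  have hclose : ∀ x ∈ S, ∀ y ∈ S, ‖(p x - p y) - (x - y)‖ ≤ ε * ‖x - y‖ := by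
    intro x hx y hy
    have : p x - p y = (x - y) - (⟪m, ν⟫⁻¹ * ⟪ν, x - y⟫) • m := by
      rw [hp]
      simp only [← map_sub]
      rw [obliqueLift_hyperplaneProj hm h.ne']
    rw [this, sub_sub_cancel_left, norm_neg, norm_smul, hm, mul_one, Real.norm_eq_abs, abs_mul,
      abs_of_pos (inv_pos.2 h), inv_mul_le_iff₀ h]
    calc _ ≤ _ := hS x hx y hy
      _ = _ := by ring
  have hε1 : (ε : ℝ) < 1 := by exact_mod_cast hε
  rw [hvol]
  constructor
  · gcongr
    refine euclideanHausdorffMeasure_image_le_of_lipschitzOnWith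
      (LipschitzOnWith.of_dist_le_mul fun x hx y hy => ?_) d
    rw [dist_eq_norm, dist_eq_norm]
    have h1 := hclose x hx y hy
    have h2 := norm_le_norm_add_norm_sub' (p x - p y) (x - y)
    push_cast
    linarith
  · rw [mul_left_comm]
    gcongr
    refine le_euclideanHausdorffMeasure_image (fun x hx y hy => ?_) d
    rw [dist_eq_norm, dist_eq_norm]
    have h1 := hclose x hx y hy
    have h2 := norm_le_norm_add_norm_sub (p x - p y) (x - y)
    rw [NNReal.coe_inv, NNReal.coe_sub hε.le, NNReal.coe_one, le_inv_mul_iff₀ (by linarith)]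
    linarith

/-- **Area formula for a projection.** Let `S` be a measurable set with a continuous unit normal
field `g`, in the sense that the chords of `S` near each point are asymptotically orthogonal to `g`.
If `S` projects injectively along `m`, and `⟪m, g⟫ > 0` on `S`, then the projection pushes forward
the surface measure with density `⟪m, g⟫` to the Lebesgue measure on the shadow of `S`. -/
theorem map_hyperplaneProj_surface {m : V} (hm : ‖m‖ = 1) {S : Set V} (hSm : MeasurableSet S)
    {g : V → V} (hgc : ContinuousOn g S) (hg1 : ∀ y ∈ S, ‖g y‖ = 1)
    (hgm : ∀ y ∈ S, 0 < ⟪m, g y⟫)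
    (htan : ∀ y ∈ S, ∀ ε > 0, ∃ W ∈ 𝓝 y, ∀ x₁ ∈ S ∩ W, ∀ x₂ ∈ S ∩ W,
      |⟪g y, x₁ - x₂⟫| ≤ ε * ‖x₁ - x₂‖)
    (hinj : Set.InjOn (hyperplaneProj m) S) :
    MeasurableSet (hyperplaneProj m '' S) ∧
    Measure.map (hyperplaneProj m)
      (((euclideanHausdorffMeasure (Module.finrank ℝ (ℝ ∙ m)ᗮ)).restrict S).withDensity
        fun x => ENNReal.ofReal ⟪m, g x⟫) = volume.restrict (hyperplaneProj m '' S) := by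
  set d := Module.finrank ℝ (ℝ ∙ m)ᗮ with hd
  have hemb : MeasurableEmbedding (S.domRestrict (hyperplaneProj m)) :=
    (hyperplaneProj m).continuous.continuousOn.measurableEmbedding hSm hinj
  have hval : MeasurableEmbedding (Subtype.val : S → V) := MeasurableEmbedding.subtype_coe hSm
  have hrange : Set.range (S.domRestrict (hyperplaneProj m)) = hyperplaneProj m '' S :=
    Set.range_domRestrict _ _
  refine ⟨hrange ▸ hemb.measurableSet_range, ?_⟩
  set f : S → ENNReal := fun y => ENNReal.ofReal ⟪m, g y⟫ with hf
  have hgc' : Continuous fun y : S => ⟪m, g y⟫ :=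
    continuous_const.inner (continuousOn_iff_continuous_domRestrict.1 hgc)
  set μ₁ : Measure S := Measure.comap (S.domRestrict (hyperplaneProj m)) volume with hμ₁
  set μ₀ : Measure S := Measure.comap Subtype.val (euclideanHausdorffMeasure d : Measure V) with hμ₀
  have hlocal : ∀ K : NNReal, 1 < K → ∀ y : S, ∃ W ∈ 𝓝 y, ∀ A ⊆ W, MeasurableSet A →
      μ₁ A ≤ K * (μ₀.withDensity f) A ∧ (μ₀.withDensity f) A ≤ K * μ₁ A := by
    intro K hK y
    have hcpos := hgm y y.2
    set c := ⟪m, g y⟫ with hc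
    -- an error `ε` for which both the Lipschitz constants and the oscillation of `⟪m, g⟫` are
    -- absorbed by `K`
    obtain ⟨ε, hε0, hε1, hεK⟩ : ∃ ε : NNReal, 0 < ε ∧ ε < 1 ∧
        (1 + ε) ^ d * (1 - ε)⁻¹ ≤ K ∧ (1 + ε) * ((1 - ε)⁻¹) ^ d ≤ K := by
      have h1 : ContinuousAt (fun ε : NNReal => (1 + ε) ^ d * (1 - ε)⁻¹) 0 := by
        refine ContinuousAt.mul (by fun_prop) (ContinuousAt.inv₀ (by fun_prop) (by simp))
      have h2 : ContinuousAt (fun ε : NNReal => (1 + ε) * ((1 - ε)⁻¹) ^ d) 0 := by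
        refine ContinuousAt.mul (by fun_prop)
          ((ContinuousAt.inv₀ (by fun_prop) (by simp)).pow d)
      have e1 := h1.eventually_lt_const (u := K) (by simpa using hK)
      have e2 := h2.eventually_lt_const (u := K) (by simpa using hK)
      have e3 : ∀ᶠ ε : NNReal in 𝓝 0, ε < 1 := eventually_lt_nhds one_pos
      obtain ⟨ε, ⟨⟨h1, h2⟩, h3⟩, h4⟩ := ((((e1.and e2).and e3).filter_mono
        nhdsWithin_le_nhds).and (self_mem_nhdsWithin : Set.Ioi (0 : NNReal) ∈ 𝓝[>] 0)).exists
      exact ⟨ε, h4, h3, h1.le, h2.le⟩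
    have hε1' : (ε : ℝ) < 1 := by exact_mod_cast hε1
    obtain ⟨W, hW, hWt⟩ := htan y y.2 (ε * c) (by positivity)
    have hosc : ∀ᶠ z : S in 𝓝 y, ⟪m, g z⟫ ∈ Set.Ioo ((1 - ε) * c) ((1 + ε) * c) := by
      refine hgc'.continuousAt.eventually (Ioo_mem_nhds ?_ ?_)
      · nlinarith [show (0 : ℝ) < ε from hε0]
      · nlinarith [show (0 : ℝ) < ε from hε0]
    refine ⟨_, Filter.inter_mem (continuous_subtype_val.continuousAt hW) hosc, fun A hA hAm => ?_⟩
    have himg : S.domRestrict (hyperplaneProj m) '' A = hyperplaneProj m '' (Subtype.val '' A) := by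
      rw [Set.image_image]; rfl
    have hμ₁A : μ₁ A = volume (hyperplaneProj m '' (Subtype.val '' A)) := by
      rw [hμ₁, hemb.comap_apply, himg]
    have hμ₀A : μ₀ A = euclideanHausdorffMeasure d (Subtype.val '' A) := by
      rw [hμ₀, hval.comap_apply]
    obtain ⟨hle1, hle2⟩ := volume_hyperplaneProj_image_approx hm (hg1 y y.2) hcpos hε1
      (S := Subtype.val '' A) (by
        rintro _ ⟨x₁, hx₁, rfl⟩ _ ⟨x₂, hx₂, rfl⟩
        exact hWt x₁ ⟨x₁.2, (hA hx₁).1⟩ x₂ ⟨x₂.2, (hA hx₂).1⟩)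
    rw [← hμ₁A, ← hμ₀A] at hle1 hle2
    rw [withDensity_apply _ hAm]
    have hone : (1 - ε)⁻¹ * (1 - ε) = 1 := inv_mul_cancel₀ (tsub_pos_of_lt hε1).ne'
    constructor
    · have hlow : ENNReal.ofReal c * μ₀ A ≤ ((1 - ε)⁻¹ : NNReal) * ∫⁻ x in A, f x ∂μ₀ := by
        have : ENNReal.ofReal ((1 - ε) * c) * μ₀ A ≤ ∫⁻ x in A, f x ∂μ₀ := by
          rw [← setLIntegral_const]
          exact setLIntegral_mono' hAm fun x hx => ENNReal.ofReal_le_ofReal (hA hx).2.1.le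
        have h3 : ENNReal.ofReal c = ((1 - ε)⁻¹ : NNReal) * ENNReal.ofReal ((1 - ε) * c) := by
          rw [ENNReal.ofReal_mul (by linarith), ← mul_assoc]
          have : ENNReal.ofReal (1 - ε) = ((1 - ε : NNReal) : ENNReal) := by
            rw [← ENNReal.ofReal_coe_nnreal, NNReal.coe_sub hε1.le, NNReal.coe_one]
          rw [this, ← ENNReal.coe_mul, hone, ENNReal.coe_one, one_mul]
        rw [h3, mul_assoc]
        gcongr
      calc μ₁ A ≤ _ := hle1
        _ = ((1 + ε : NNReal) : ENNReal) ^ d * (ENNReal.ofReal c * μ₀ A) := by ring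
        _ ≤ ((1 + ε : NNReal) : ENNReal) ^ d * (((1 - ε)⁻¹ : NNReal) * ∫⁻ x in A, f x ∂μ₀) := by
          gcongr
        _ = (((1 + ε) ^ d * (1 - ε)⁻¹ : NNReal) : ENNReal) * ∫⁻ x in A, f x ∂μ₀ := by
          push_cast; ring
        _ ≤ _ := by gcongr; exact hεK.1
    · have hup : ∫⁻ x in A, f x ∂μ₀ ≤ (1 + ε : NNReal) * (ENNReal.ofReal c * μ₀ A) := by
        have h3 : ∫⁻ x in A, f x ∂μ₀ ≤ ENNReal.ofReal ((1 + ε) * c) * μ₀ A := by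
          rw [← setLIntegral_const]
          exact setLIntegral_mono' hAm fun x hx => ENNReal.ofReal_le_ofReal (hA hx).2.2.le
        refine h3.trans (le_of_eq ?_)
        rw [ENNReal.ofReal_mul (by positivity), ← mul_assoc]
        congr 2
        rw [← ENNReal.ofReal_coe_nnreal]
        simp
      calc ∫⁻ x in A, f x ∂μ₀ ≤ _ := hup
        _ ≤ (1 + ε : NNReal) * ((((1 - ε)⁻¹ : NNReal) : ENNReal) ^ d * μ₁ A) := by
          gcongr
        _ = (((1 + ε) * ((1 - ε)⁻¹) ^ d : NNReal) : ENNReal) * μ₁ A := by push_cast; ring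
        _ ≤ _ := by gcongr; exact hεK.2
  -- Let `K` tend to one.
  have heq : μ₁ = μ₀.withDensity f := by
    refine le_antisymm (Measure.le_iff'.2 fun A => ?_) (Measure.le_iff'.2 fun A => ?_)
    · refine ENNReal.le_of_forall_one_lt_le_mul fun K hK => ?_
      have : μ₁ ≤ (K : ENNReal) • μ₀.withDensity f := Measure.le_of_locally_le fun y => by
        obtain ⟨W, hW, h⟩ := hlocal K hK y
        exact ⟨W, hW, fun A hA hAm => (h A hA hAm).1⟩
      exact Measure.le_iff'.1 this A
    · refine ENNReal.le_of_forall_one_lt_le_mul fun K hK => ?_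
      have : μ₀.withDensity f ≤ (K : ENNReal) • μ₁ := Measure.le_of_locally_le fun y => by
        obtain ⟨W, hW, h⟩ := hlocal K hK y
        exact ⟨W, hW, fun A hA hAm => (h A hA hAm).2⟩
      exact Measure.le_iff'.1 this A
  refine Measure.ext fun B hB => ?_
  have hBm := hB.preimage (hyperplaneProj m).continuous.measurable
  rw [Measure.map_apply (hyperplaneProj m).continuous.measurable hB, withDensity_apply _ hBm,
    Measure.restrict_restrict hBm, Measure.restrict_apply hB, ← hrange]
  have h1 : volume (B ∩ Set.range (S.domRestrict (hyperplaneProj m))) =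
      μ₁ (S.domRestrict (hyperplaneProj m) ⁻¹' B) := by
    rw [hμ₁, hemb.comap_apply, Set.image_preimage_eq_inter_range]
  have hBm' : MeasurableSet (S.domRestrict (hyperplaneProj m) ⁻¹' B) := hB.preimage hemb.measurable
  rw [h1, heq, withDensity_apply _ hBm', hf]
  refine Eq.trans ?_ (setLIntegral_subtype hSm _ fun x => ENNReal.ofReal ⟪m, g x⟫).symm
  congr 2
  ext x
  simp [and_comm]

end AreaFormula

/-! ### The divergence theorem in one direction -/

section DirectionalDivergence

variable {V : Type*} [NormedAddCommGroup V] [InnerProductSpace ℝ V] [FiniteDimensional ℝ V]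
  [MeasurableSpace V] [BorelSpace V]

open Measure

/-- Cartesian coordinates on `V`, along the unit vector `m` and orthogonal to it. -/
noncomputable def lineCoord {m : V} (hm : ‖m‖ = 1) : ℝ × (ℝ ∙ m)ᗮ ≃ᵐ V :=
  (MeasurableEquiv.prodCongr
    (LinearIsometryEquiv.toSpanUnitSingleton m hm).toHomeomorph.toMeasurableEquiv
    (MeasurableEquiv.refl _)).trans (Submodule.measurableEquivProd (ℝ ∙ m) (0 : V)).symm

theorem lineCoord_apply {m : V} (hm : ‖m‖ = 1) (p : ℝ × (ℝ ∙ m)ᗮ) :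
    lineCoord hm p = (p.2 : V) + p.1 • m := by
  rw [lineCoord, MeasurableEquiv.trans_apply, Submodule.measurableEquivProd_symm_apply,
    vadd_eq_add, add_zero, add_comm]
  rfl

theorem measurePreserving_lineCoord {m : V} (hm : ‖m‖ = 1) :
    MeasurePreserving (lineCoord hm) volume volume := by
  have h1 := (Submodule.measurePreserving_measurableEquivProd (ℝ ∙ m) (0 : V)).symm
  rw [InnerProductSpace.euclideanHausdorffMeasure_eq_volume] at h1
  refine h1.comp ?_
  exact (LinearIsometryEquiv.measurePreserving (LinearIsometryEquiv.toSpanUnitSingleton m hm)).prod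
    (MeasurePreserving.id _)

/-- An open set `U` in which `Ω` is the part below its boundary, where `m` points upwards, and whose
boundary `frontier Ω ∩ U` has the normal field `ν` and satisfies the area formula for the projection
along `m`. -/
structure IsAdaptedBox (Ω U : Set V) (m : V) (ν : V → V) : Prop where
  norm_eq : ‖m‖ = 1
  isOpen : IsOpen U
  mem_of_below : ∀ x ∈ closure Ω ∩ U, ∀ s > (0 : ℝ), x - s • m ∈ U → x - s • m ∈ Ω
  continuousOn : ContinuousOn ν (frontier Ω ∩ U)
  inner_pos : ∀ x ∈ frontier Ω ∩ U, 0 < ⟪m, ν x⟫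
  map_proj : Measure.map (hyperplaneProj m)
      (((euclideanHausdorffMeasure (Module.finrank ℝ (ℝ ∙ m)ᗮ)).restrict
        (frontier Ω ∩ U)).withDensity fun x => ENNReal.ofReal ⟪m, ν x⟫) =
      volume.restrict (hyperplaneProj m '' (frontier Ω ∩ U))
  measurableSet_proj : MeasurableSet (hyperplaneProj m '' (frontier Ω ∩ U))

variable {Ω U K : Set V} {m : V} {ν : V → V} {F F' : V → ℝ}

omit [FiniteDimensional ℝ V] [MeasurableSpace V] [BorelSpace V] in
theorem eq_zero_of_hasDerivAt_line_of_notMem (hK : IsClosed K) (hF : ∀ x ∉ K, F x = 0)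
    (hF' : ∀ x ∈ Ω, HasDerivAt (fun s : ℝ => F (x + s • m)) (F' x) 0) {x : V} (hx : x ∈ Ω)
    (hxK : x ∉ K) : F' x = 0 := by
  have hev : (fun s : ℝ => F (x + s • m)) =ᶠ[𝓝 0] fun _ => 0 := by
    have hc : ContinuousAt (fun s : ℝ => x + s • m) 0 := by fun_prop
    have : ∀ᶠ s : ℝ in 𝓝 0, x + s • m ∈ Kᶜ :=
      hc.eventually_mem (by simpa using hK.isOpen_compl.mem_nhds hxK)
    filter_upwards [this] with s hs using hF _ hs
  exact (hF' x hx).unique ((hasDerivAt_const (0 : ℝ) (0 : ℝ)).congr_of_eventuallyEq hev)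

omit [FiniteDimensional ℝ V] [MeasurableSpace V] [BorelSpace V] in
theorem hasDerivAt_line_of_hasDerivAt_zero {x : V} {s c : ℝ}
    (h : HasDerivAt (fun t : ℝ => F (x + s • m + t • m)) c 0) :
    HasDerivAt (fun t : ℝ => F (x + t • m)) c s := by
  have h1 : HasDerivAt (fun t : ℝ => t - s) 1 s := (hasDerivAt_id s).sub_const s
  have h2 : HasDerivAt (fun t : ℝ => F (x + s • m + t • m)) c ((fun t : ℝ => t - s) s) := by
    beta_reduce
    rwa [sub_self]
  have := HasDerivAt.comp (h := fun t : ℝ => t - s) s h2 h1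
  rw [mul_one] at this
  refine this.congr_of_eventuallyEq (Eventually.of_forall fun t => ?_)
  simp only [Function.comp]
  rw [add_assoc, ← add_smul, add_sub_cancel]

/-- The fundamental theorem of calculus on a line which crosses the boundary. -/
theorem IsAdaptedBox.integral_line_eq (hb : IsAdaptedBox Ω U m ν) (hΩ : IsOpen Ω)
    (hK : IsCompact K) (hKU : K ⊆ U) (hF : ∀ x ∉ K, F x = 0) (hFc : ContinuousOn F (closure Ω))
    (hF' : ∀ x ∈ Ω, HasDerivAt (fun s : ℝ => F (x + s • m)) (F' x) 0) {x : V} {s₀ : ℝ}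
    (hs₀ : x + s₀ • m ∈ frontier Ω ∩ U)
    (hint : Integrable fun s : ℝ => Ω.indicator F' (x + s • m)) :
    ∫ s : ℝ, Ω.indicator F' (x + s • m) = F (x + s₀ • m) := by
  have hline : Continuous fun s : ℝ => x + s • m := by fun_prop
  have hbelow : ∀ s < s₀, x + s • m ∈ U → x + s • m ∈ Ω := by
    intro s hs hsU
    have h := hb.mem_of_below (x + s₀ • m) ⟨frontier_subset_closure hs₀.1, hs₀.2⟩ (s₀ - s)
      (by linarith)
    have e : x + s₀ • m - (s₀ - s) • m = x + s • m := by module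
    rw [e] at h
    exact h hsU
  have habove : ∀ s > s₀, x + s • m ∈ U → x + s • m ∉ Ω := by
    intro s hs hsU hsΩ
    have h := hb.mem_of_below (x + s • m) ⟨subset_closure hsΩ, hsU⟩ (s - s₀) (by linarith)
    have e : x + s • m - (s - s₀) • m = x + s₀ • m := by module
    rw [e] at h
    have h3 := hs₀.1
    rw [hΩ.frontier_eq] at h3
    exact h3.2 (h hs₀.2)
  have hzero : ∀ s > s₀, Ω.indicator F' (x + s • m) = 0 := by
    intro s hs
    by_cases hsΩ : x + s • m ∈ Ω
    · rw [Set.indicator_of_mem hsΩ]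
      refine eq_zero_of_hasDerivAt_line_of_notMem hK.isClosed hF hF' hsΩ fun hsK => ?_
      exact habove s hs (hKU hsK) hsΩ
    · exact Set.indicator_of_notMem hsΩ _
  have h1 : ∫ s in Set.Iic s₀, Ω.indicator F' (x + s • m) = F (x + s₀ • m) - 0 := by
    refine integral_Iic_of_hasDerivAt_of_tendsto (f := fun s : ℝ => F (x + s • m)) ?_ ?_
      hint.integrableOn ?_
    · have hU : ∀ᶠ s in 𝓝[≤] s₀, x + s • m ∈ U :=
        (hline.continuousAt.eventually_mem (hb.isOpen.mem_nhds hs₀.2)).filter_mono nhdsWithin_le_nhds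
      have := hFc _ (frontier_subset_closure hs₀.1)
      refine ContinuousWithinAt.comp_of_preimage_mem_nhdsWithin (f := fun s : ℝ => x + s • m)
        this hline.continuousWithinAt ?_
      filter_upwards [hU, self_mem_nhdsWithin] with s hs hs'
      rcases (Set.mem_Iic.1 hs').eq_or_lt with rfl | h
      · exact frontier_subset_closure hs₀.1
      · exact subset_closure (hbelow s h hs)
    · intro s hs
      by_cases hsK : x + s • m ∈ K
      · have hsΩ := hbelow s hs (hKU hsK)
        simp only [Set.indicator_of_mem hsΩ]
        exact hasDerivAt_line_of_hasDerivAt_zero (hF' _ hsΩ)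
      · have h0 : Ω.indicator F' (x + s • m) = 0 := by
          by_cases hsΩ : x + s • m ∈ Ω
          · rw [Set.indicator_of_mem hsΩ]
            exact eq_zero_of_hasDerivAt_line_of_notMem hK.isClosed hF hF' hsΩ hsK
          · exact Set.indicator_of_notMem hsΩ _
        simp only [h0]
        refine (hasDerivAt_const s (0 : ℝ)).congr_of_eventuallyEq ?_
        filter_upwards [hline.continuousAt.eventually_mem (hK.isClosed.isOpen_compl.mem_nhds hsK)]
          with t ht using hF _ ht
    · refine tendsto_const_nhds.congr' ?_
      obtain ⟨C, hC⟩ := hK.isBounded.exists_norm_le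
      filter_upwards [eventually_lt_atBot (-(C + ‖x‖))] with s hs
      refine (hF _ fun hmem => ?_).symm
      have h3 := hC _ hmem
      have h4 : ‖s • m‖ ≤ ‖x + s • m‖ + ‖x‖ := by
        have := norm_sub_le (x + s • m) x
        rwa [add_sub_cancel_left] at this
      rw [norm_smul, hb.norm_eq, mul_one, Real.norm_eq_abs] at h4
      have := neg_le_abs s
      linarith
  rw [sub_zero] at h1
  rw [← h1, setIntegral_eq_integral_of_forall_compl_eq_zero]
  intro s hs
  exact hzero s (not_le.1 hs)

omit [FiniteDimensional ℝ V] [MeasurableSpace V] [BorelSpace V] in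
/-- The fundamental theorem of calculus on a line which misses the boundary. -/
theorem integral_line_eq_zero (hm : ‖m‖ = 1) (hΩ : IsOpen Ω)
    (hK : IsCompact K) (hKU : K ⊆ U) (hF : ∀ x ∉ K, F x = 0)
    (hF' : ∀ x ∈ Ω, HasDerivAt (fun s : ℝ => F (x + s • m)) (F' x) 0) {x : V}
    (hs₀ : ∀ s : ℝ, x + s • m ∉ frontier Ω ∩ U)
    (hint : Integrable fun s : ℝ => Ω.indicator F' (x + s • m)) :
    ∫ s : ℝ, Ω.indicator F' (x + s • m) = 0 := by
  have hline : Continuous fun s : ℝ => x + s • m := by fun_prop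
  have hder : ∀ s : ℝ, HasDerivAt (fun t : ℝ => Ω.indicator F (x + t • m))
      (Ω.indicator F' (x + s • m)) s := by
    intro s
    by_cases hsΩ : x + s • m ∈ Ω
    · rw [Set.indicator_of_mem hsΩ]
      refine (hasDerivAt_line_of_hasDerivAt_zero (hF' _ hsΩ)).congr_of_eventuallyEq ?_
      filter_upwards [hline.continuousAt.eventually_mem (hΩ.mem_nhds hsΩ)] with t ht
      exact Set.indicator_of_mem ht _
    · rw [Set.indicator_of_notMem hsΩ]
      refine (hasDerivAt_const s (0 : ℝ)).congr_of_eventuallyEq ?_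
      by_cases hsK : x + s • m ∈ K
      · have hcl : x + s • m ∉ closure Ω := fun h =>
          hs₀ s ⟨by rw [hΩ.frontier_eq]; exact ⟨h, hsΩ⟩, hKU hsK⟩
        filter_upwards [hline.continuousAt.eventually_mem
          (isClosed_closure.isOpen_compl.mem_nhds hcl)] with t ht
        exact Set.indicator_of_notMem (fun h => ht (subset_closure h)) _
      · filter_upwards [hline.continuousAt.eventually_mem
          (hK.isClosed.isOpen_compl.mem_nhds hsK)] with t ht
        by_cases htΩ : x + t • m ∈ Ω
        · rw [Set.indicator_of_mem htΩ, hF _ ht]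
        · exact Set.indicator_of_notMem htΩ _
  obtain ⟨C, hC⟩ := hK.isBounded.exists_norm_le
  have hfar : ∀ s : ℝ, C + ‖x‖ < |s| → 0 = Ω.indicator F (x + s • m) := by
    intro s hs
    have : F (x + s • m) = 0 := by
      refine hF _ fun hmem => ?_
      have h3 := hC _ hmem
      have h4 : ‖s • m‖ ≤ ‖x + s • m‖ + ‖x‖ := by
        have := norm_sub_le (x + s • m) x
        rwa [add_sub_cancel_left] at this
      rw [norm_smul, hm, mul_one, Real.norm_eq_abs] at h4
      linarith
    by_cases htΩ : x + s • m ∈ Ω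
    · rw [Set.indicator_of_mem htΩ, this]
    · exact (Set.indicator_of_notMem htΩ _).symm
  rw [integral_of_hasDerivAt_of_tendsto hder hint (m := 0) (n := 0), sub_zero]
  · refine tendsto_const_nhds.congr' ?_
    filter_upwards [eventually_lt_atBot (-(C + ‖x‖))] with s hs
    exact hfar s (by have := neg_le_abs s; linarith)
  · refine tendsto_const_nhds.congr' ?_
    filter_upwards [eventually_gt_atTop (C + ‖x‖)] with s hs
    exact hfar s (by have := le_abs_self s; linarith)

/-- **Divergence theorem in one direction**, for functions with compact support in an adapted box.
The function only has to be differentiable in the direction `m`, with derivative `F'`. -/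
theorem IsAdaptedBox.integral_lineDeriv (hb : IsAdaptedBox Ω U m ν) (hΩ : IsOpen Ω)
    (hK : IsCompact K) (hKU : K ⊆ U) (hF : ∀ x ∉ K, F x = 0) (hFc : ContinuousOn F (closure Ω))
    (hF' : ∀ x ∈ Ω, HasDerivAt (fun s : ℝ => F (x + s • m)) (F' x) 0)
    (hint : IntegrableOn F' Ω) :
    ∫ x in Ω, F' x = ∫ x in frontier Ω,
      F x * ⟪m, ν x⟫ ∂(euclideanHausdorffMeasure (Module.finrank ℝ (ℝ ∙ m)ᗮ)) := by
  have hm := hb.norm_eq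
  set μs : Measure V := euclideanHausdorffMeasure (Module.finrank ℝ (ℝ ∙ m)ᗮ) with hμs
  set P := hyperplaneProj m '' (frontier Ω ∩ U) with hP
  have hSm : MeasurableSet (frontier Ω ∩ U) :=
    isClosed_frontier.measurableSet.inter hb.isOpen.measurableSet
  have hint' : Integrable (Ω.indicator F') := hint.integrable_indicator hΩ.measurableSet
  have hmp := measurePreserving_lineCoord hm
  have hemb := (lineCoord hm).measurableEmbedding
  have hintp : Integrable (fun p : ℝ × (ℝ ∙ m)ᗮ => Ω.indicator F' ((p.2 : V) + p.1 • m))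
      (volume.prod volume) := by
    have := (hmp.integrable_comp_emb hemb).2 hint'
    refine this.congr (Eventually.of_forall fun p => ?_)
    simp only [Function.comp, lineCoord_apply]
  set H : (ℝ ∙ m)ᗮ → ℝ := fun x => ∫ s : ℝ, Ω.indicator F' ((x : V) + s • m) with hH
  have hHint : Integrable H := hintp.integral_prod_right
  have hsec : ∀ᵐ x : (ℝ ∙ m)ᗮ, Integrable fun s : ℝ => Ω.indicator F' ((x : V) + s • m) :=
    hintp.prod_left_ae
  have hproj : ∀ y : V, ((hyperplaneProj m y : (ℝ ∙ m)ᗮ) : V) + ⟪m, y⟫ • m = y := fun y => by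
    rw [coe_hyperplaneProj hm, sub_add_cancel]
  have hHon : ∀ᵐ x : (ℝ ∙ m)ᗮ, ∀ y ∈ frontier Ω ∩ U, hyperplaneProj m y = x → H x = F y := by
    filter_upwards [hsec] with x hx y hy hyx
    have hyx' : (x : V) + ⟪m, y⟫ • m = y := by rw [← hyx, hproj]
    rw [hH]
    simp only
    rw [hb.integral_line_eq hΩ hK hKU hF hFc hF' (s₀ := ⟪m, y⟫) (by rwa [hyx']) hx, hyx']
  have hHoff : ∀ᵐ x : (ℝ ∙ m)ᗮ, x ∉ P → H x = 0 := by
    filter_upwards [hsec] with x hx hxP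
    refine integral_line_eq_zero hm hΩ hK hKU hF hF' (fun s hs => hxP ⟨_, hs, ?_⟩) hx
    have hmem := Submodule.mem_orthogonal_singleton_iff_inner_right.1 x.2
    apply Subtype.ext
    rw [coe_hyperplaneProj hm, inner_add_right, hmem, inner_smul_right,
      real_inner_self_eq_norm_sq, hm]
    simp
  calc ∫ x in Ω, F' x = ∫ x, Ω.indicator F' x := (integral_indicator hΩ.measurableSet).symm
    _ = ∫ p : ℝ × (ℝ ∙ m)ᗮ, Ω.indicator F' ((p.2 : V) + p.1 • m) ∂(volume.prod volume) := by
      rw [← hmp.integral_comp hemb]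
      simp only [lineCoord_apply]
      rfl
    _ = ∫ x, H x := integral_prod_symm _ hintp
    _ = ∫ x in P, H x := (setIntegral_eq_integral_of_ae_compl_eq_zero hHoff).symm
    _ = ∫ y, H (hyperplaneProj m y) ∂((μs.restrict (frontier Ω ∩ U)).withDensity
          fun x => ENNReal.ofReal ⟪m, ν x⟫) := by
      rw [← hb.map_proj, integral_map (hyperplaneProj m).continuous.aemeasurable]
      rw [hb.map_proj]
      exact hHint.aestronglyMeasurable.restrict
    _ = ∫ y in frontier Ω ∩ U, (ENNReal.ofReal ⟪m, ν y⟫).toReal • H (hyperplaneProj m y) ∂μs := by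
      refine integral_withDensity_eq_integral_toReal_smul₀ ?_ ?_ _
      · exact ((continuousOn_const.inner hb.continuousOn).aemeasurable hSm).ennreal_ofReal
      · exact Eventually.of_forall fun x => ENNReal.ofReal_lt_top
    _ = ∫ y in frontier Ω ∩ U, F y * ⟪m, ν y⟫ ∂μs := by
      refine integral_congr_ae ?_
      have h1 : ∀ᵐ y ∂((μs.restrict (frontier Ω ∩ U)).withDensity
          fun x => ENNReal.ofReal ⟪m, ν x⟫), ∀ z ∈ frontier Ω ∩ U,
          hyperplaneProj m z = hyperplaneProj m y → H (hyperplaneProj m y) = F z := by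
        refine ae_of_ae_map (hyperplaneProj m).continuous.aemeasurable (p := fun x =>
          ∀ z ∈ frontier Ω ∩ U, hyperplaneProj m z = x → H x = F z) ?_
        rw [hb.map_proj]
        exact ae_restrict_of_ae hHon
      rw [ae_withDensity_iff'
        ((continuousOn_const.inner hb.continuousOn).aemeasurable hSm).ennreal_ofReal] at h1
      filter_upwards [h1, ae_restrict_mem hSm] with y hy hyS
      have hpos := hb.inner_pos y hyS
      rw [hy (ENNReal.ofReal_pos.2 hpos).ne' y hyS rfl, ENNReal.toReal_ofReal hpos.le, smul_eq_mul,
        mul_comm]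
    _ = ∫ y in frontier Ω, F y * ⟪m, ν y⟫ ∂μs := by
      refine (setIntegral_eq_of_subset_of_forall_sdiff_eq_zero isClosed_frontier.measurableSet
        Set.inter_subset_left fun y hy => ?_).symm
      rw [hF y fun hyK => hy.2 ⟨hy.1, hKU hyK⟩, zero_mul]

end DirectionalDivergence

/-! ### Defining functions of a domain of class `C²` -/

section DefiningFunction

variable {N : ℕ} {Ω U : Set (EuclideanSpace ℝ (Fin N))} {φ : EuclideanSpace ℝ (Fin N) → ℝ}

/-- `φ` is a regular `C²` defining function of `Ω` in the open set `U`. -/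
structure IsDefiningOn (Ω U : Set (EuclideanSpace ℝ (Fin N)))
    (φ : EuclideanSpace ℝ (Fin N) → ℝ) : Prop where
  isOpen : IsOpen U
  contDiffOn : ContDiffOn ℝ 2 φ U
  mem_iff : ∀ y ∈ U, (y ∈ Ω ↔ φ y < 0)
  gradient_ne : ∀ y ∈ U, gradient φ y ≠ 0

/-- The normalized gradient of `φ`. -/
noncomputable def unitGradient (φ : EuclideanSpace ℝ (Fin N) → ℝ) (x : EuclideanSpace ℝ (Fin N)) :
    EuclideanSpace ℝ (Fin N) :=
  ‖gradient φ x‖⁻¹ • gradient φ x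

namespace IsDefiningOn

theorem contDiffAt (h : IsDefiningOn Ω U φ) {y : EuclideanSpace ℝ (Fin N)} (hy : y ∈ U) :
    ContDiffAt ℝ 2 φ y := h.contDiffOn.contDiffAt (h.isOpen.mem_nhds hy)

theorem hasStrictFDerivAt (h : IsDefiningOn Ω U φ) {y : EuclideanSpace ℝ (Fin N)} (hy : y ∈ U) :
    HasStrictFDerivAt φ (innerSL ℝ (gradient φ y)) y := by
  have := (h.contDiffAt hy).hasStrictFDerivAt two_ne_zero
  have heq : innerSL ℝ (gradient φ y) = fderiv ℝ φ y := by
    refine ContinuousLinearMap.ext fun v => ?_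
    rw [innerSL_apply_apply, inner_gradient_left]
  rwa [heq]

theorem hasDerivAt_line (h : IsDefiningOn Ω U φ) {y v : EuclideanSpace ℝ (Fin N)} {t : ℝ}
    (hy : y + t • v ∈ U) :
    HasDerivAt (fun s : ℝ => φ (y + s • v)) ⟪gradient φ (y + t • v), v⟫ t := by
  have h1 : HasDerivAt (fun s : ℝ => y + s • v) v t := by
    simpa using ((hasDerivAt_id t).smul_const v).const_add y
  exact (h.hasStrictFDerivAt hy).hasFDerivAt.comp_hasDerivAt t h1

theorem contDiffOn_gradient (h : IsDefiningOn Ω U φ) : ContDiffOn ℝ 1 (gradient φ) U := by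
  have h1 : ContDiffOn ℝ 1 (fderiv ℝ φ) U := h.contDiffOn.fderiv_of_isOpen h.isOpen (by norm_num)
  exact (InnerProductSpace.toDual ℝ
    (EuclideanSpace ℝ (Fin N))).symm.toContinuousLinearEquiv.contDiff.comp_contDiffOn h1

theorem contDiffOn_unitGradient (h : IsDefiningOn Ω U φ) :
    ContDiffOn ℝ 1 (unitGradient φ) U := by
  have hinv : ContDiffOn ℝ 1 (fun x => ‖gradient φ x‖⁻¹) U :=
    (h.contDiffOn_gradient.norm ℝ h.gradient_ne).inv fun x hx =>
      norm_ne_zero_iff.2 (h.gradient_ne x hx)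
  exact hinv.smul h.contDiffOn_gradient

theorem norm_unitGradient (h : IsDefiningOn Ω U φ) {y : EuclideanSpace ℝ (Fin N)} (hy : y ∈ U) :
    ‖unitGradient φ y‖ = 1 := by
  rw [unitGradient, norm_smul, norm_inv, norm_norm,
    inv_mul_cancel₀ (norm_ne_zero_iff.2 (h.gradient_ne y hy))]

theorem nonpos_of_mem_closure (h : IsDefiningOn Ω U φ) {y : EuclideanSpace ℝ (Fin N)} (hy : y ∈ U)
    (hyc : y ∈ closure Ω) : φ y ≤ 0 := by
  by_contra hpos
  have h1 : ∀ᶠ z in 𝓝 y, 0 < φ z ∧ z ∈ U :=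
    ((h.contDiffAt hy).continuousAt.eventually_const_lt (not_le.1 hpos)).and
      (h.isOpen.mem_nhds hy)
  obtain ⟨z, ⟨hz1, hz2⟩, hz3⟩ := mem_closure_iff_nhds.1 hyc _ h1
  exact absurd ((h.mem_iff z hz2).1 hz3) hz1.not_gt

theorem isExteriorUnitNormal (h : IsDefiningOn Ω U φ) {y : EuclideanSpace ℝ (Fin N)} (hy : y ∈ U)
    (h0 : φ y = 0) : IsExteriorUnitNormal Ω y (unitGradient φ y) := by
  have hg := norm_pos_iff.2 (h.gradient_ne y hy)
  have hsign : ∀ v, ⟪v, unitGradient φ y⟫ = ‖gradient φ y‖⁻¹ * ⟪gradient φ y, v⟫ := fun v => by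
    rw [unitGradient, inner_smul_right, real_inner_comm]
  have hder : ∀ v : EuclideanSpace ℝ (Fin N),
      HasDerivAt (fun s : ℝ => φ (y + s • v)) ⟪gradient φ y, v⟫ 0 := fun v => by
    have := h.hasDerivAt_line (y := y) (v := v) (t := 0) (by simpa using hy)
    simpa using this
  have hU : ∀ v : EuclideanSpace ℝ (Fin N), ∀ᶠ t : ℝ in 𝓝[>] 0, y + t • v ∈ U := fun v => by
    have hc : ContinuousAt (fun s : ℝ => y + s • v) 0 := by fun_prop
    exact (hc.eventually_mem (by simpa using h.isOpen.mem_nhds hy)).filter_mono nhdsWithin_le_nhds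
  refine ⟨h.norm_unitGradient hy, fun v hv => ?_, fun v hv => ?_⟩
  · rw [hsign] at hv
    have hv' : ⟪gradient φ y, v⟫ < 0 := by
      by_contra hc
      exact absurd hv (not_lt.2 (mul_nonneg (inv_nonneg.2 hg.le) (not_lt.1 hc)))
    have hs := (hasDerivAt_iff_tendsto_slope.1 (hder v)).eventually_lt_const hv'
    filter_upwards [hs.filter_mono (nhdsGT_le_nhdsNE 0), hU v, self_mem_nhdsWithin] with t h1 h2 h3
    rw [h.mem_iff _ h2]
    rw [slope_def_field, sub_zero, zero_smul, add_zero, h0, sub_zero] at h1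
    exact (div_neg_iff.1 h1).resolve_left (fun h4 => absurd h4.2 (not_lt.2 (Set.mem_Ioi.1 h3).le))
      |>.1
  · rw [hsign] at hv
    have hv' : 0 < ⟪gradient φ y, v⟫ := by
      by_contra hc
      exact absurd hv (not_lt.2 (mul_nonpos_of_nonneg_of_nonpos (inv_nonneg.2 hg.le) (not_lt.1 hc)))
    have hs := (hasDerivAt_iff_tendsto_slope.1 (hder v)).eventually_const_lt hv'
    filter_upwards [hs.filter_mono (nhdsGT_le_nhdsNE 0), hU v, self_mem_nhdsWithin] with t h1 h2 h3
    intro hc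
    have h4 := h.nonpos_of_mem_closure h2 hc
    rw [slope_def_field, sub_zero, zero_smul, add_zero, h0, sub_zero] at h1
    exact absurd h1 (not_lt.2 (div_nonpos_of_nonpos_of_nonneg h4 (Set.mem_Ioi.1 h3).le))

theorem mem_frontier_iff (h : IsDefiningOn Ω U φ) (hΩ : IsOpen Ω) {y : EuclideanSpace ℝ (Fin N)}
    (hy : y ∈ U) : y ∈ frontier Ω ↔ φ y = 0 := by
  rw [hΩ.frontier_eq]
  constructor
  · rintro ⟨h1, h2⟩
    rw [h.mem_iff y hy, not_lt] at h2
    exact le_antisymm (h.nonpos_of_mem_closure hy h1) h2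
  · intro h0
    refine ⟨?_, by rw [h.mem_iff y hy, h0]; exact lt_irrefl 0⟩
    obtain ⟨h1, h2, -⟩ := h.isExteriorUnitNormal hy h0
    have h3 := h2 (-unitGradient φ y) (by
      rw [inner_neg_left, real_inner_self_eq_norm_sq, h1]; norm_num)
    have hc : Tendsto (fun t : ℝ => y + t • -unitGradient φ y) (𝓝[>] 0) (𝓝 y) := by
      have : ContinuousAt (fun t : ℝ => y + t • -unitGradient φ y) 0 := by fun_prop
      have h4 := this.tendsto
      simp only [zero_smul, add_zero] at h4
      exact h4.mono_left nhdsWithin_le_nhds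
    exact mem_closure_of_tendsto hc h3

theorem extNormal_eq (h : IsDefiningOn Ω U φ) (hΩ : IsOpen Ω) {y : EuclideanSpace ℝ (Fin N)}
    (hy : y ∈ frontier Ω ∩ U) : extNormal Ω y = unitGradient φ y :=
  (h.isExteriorUnitNormal hy.2 ((h.mem_frontier_iff hΩ hy.2).1 hy.1)).extNormal_eq

/-- The chords of the boundary near a point are asymptotically orthogonal to the normal. -/
theorem exists_chord_bound (h : IsDefiningOn Ω U φ) (hΩ : IsOpen Ω)
    {y : EuclideanSpace ℝ (Fin N)} (hy : y ∈ frontier Ω ∩ U) {ε : ℝ} (hε : 0 < ε) :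
    ∃ W ∈ 𝓝 y, ∀ x₁ ∈ (frontier Ω ∩ U) ∩ W, ∀ x₂ ∈ (frontier Ω ∩ U) ∩ W,
      |⟪extNormal Ω y, x₁ - x₂⟫| ≤ ε * ‖x₁ - x₂‖ := by
  have hg := norm_pos_iff.2 (h.gradient_ne y hy.2)
  have h1 := (h.hasStrictFDerivAt hy.2).isLittleO.def (c := ε * ‖gradient φ y‖) (by positivity)
  rw [nhds_prod_eq] at h1
  obtain ⟨W, hW, hWt⟩ := (𝓝 y).basis_sets.prod_self.eventually_iff.1 h1
  refine ⟨W, hW, fun x₁ hx₁ x₂ hx₂ => ?_⟩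
  have h2 := hWt (Set.mk_mem_prod hx₁.2 hx₂.2)
  simp only [(h.mem_frontier_iff hΩ hx₁.1.2).1 hx₁.1.1, (h.mem_frontier_iff hΩ hx₂.1.2).1 hx₂.1.1,
    innerSL_apply_apply, sub_zero, zero_sub, norm_neg] at h2
  rw [h.extNormal_eq hΩ hy, unitGradient, inner_smul_left, conj_trivial, abs_mul,
    abs_of_pos (inv_pos.2 hg), inv_mul_le_iff₀ hg]
  calc _ ≤ _ := h2
    _ = _ := by ring

/-- A defining function increases in the directions which make an acute angle with its gradient. -/
theorem lt_of_below (h : IsDefiningOn Ω U φ) (hU : Convex ℝ U) {m : EuclideanSpace ℝ (Fin N)}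
    (hm : ∀ y ∈ U, 0 < ⟪gradient φ y, m⟫) {x : EuclideanSpace ℝ (Fin N)} (hx : x ∈ U) {s : ℝ}
    (hs : 0 < s) (hxs : x - s • m ∈ U) : φ (x - s • m) < φ x := by
  have hseg : ∀ t ∈ Set.Icc 0 s, x - s • m + t • m ∈ U := by
    intro t ht
    have := hU.add_smul_mem hxs (y := s • m) (by simpa using hx) (t := t / s)
      ⟨div_nonneg ht.1 hs.le, (div_le_one hs).2 ht.2⟩
    rwa [smul_smul, div_mul_cancel₀ _ hs.ne'] at this
  obtain ⟨c, hc, hceq⟩ := exists_hasDerivAt_eq_slope (fun t : ℝ => φ (x - s • m + t • m))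
    (fun t => ⟪gradient φ (x - s • m + t • m), m⟫) hs
    (fun t ht => (h.hasDerivAt_line (hseg t ht)).continuousAt.continuousWithinAt)
    (fun t ht => h.hasDerivAt_line (hseg t ⟨ht.1.le, ht.2.le⟩))
  have hpos := hm _ (hseg c ⟨hc.1.le, hc.2.le⟩)
  rw [hceq, zero_smul, add_zero, sub_add_cancel, sub_zero] at hpos
  have := (div_pos_iff_of_pos_right hs).1 hpos
  linarith

/-- A convex neighbourhood in which the boundary is a graph in the direction `m` is an adapted box. -/
theorem isAdaptedBox (h : IsDefiningOn Ω U φ) (hΩ : IsOpen Ω) (hU : Convex ℝ U)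
    {m : EuclideanSpace ℝ (Fin N)} (hm1 : ‖m‖ = 1) (hm : ∀ y ∈ U, 0 < ⟪gradient φ y, m⟫) :
    IsAdaptedBox Ω U m (extNormal Ω) := by
  have hbelow : ∀ x ∈ closure Ω ∩ U, ∀ s > (0 : ℝ), x - s • m ∈ U → x - s • m ∈ Ω := by
    intro x hx s hs hxs
    rw [h.mem_iff _ hxs]
    exact (h.lt_of_below hU hm hx.2 hs hxs).trans_le (h.nonpos_of_mem_closure hx.2 hx.1)
  have hcont : ContinuousOn (extNormal Ω) (frontier Ω ∩ U) :=
    (h.contDiffOn_unitGradient.continuousOn.mono Set.inter_subset_right).congr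
      fun y hy => h.extNormal_eq hΩ hy
  have hpos : ∀ x ∈ frontier Ω ∩ U, 0 < ⟪m, extNormal Ω x⟫ := by
    intro x hx
    rw [h.extNormal_eq hΩ hx, unitGradient, inner_smul_right, real_inner_comm]
    exact mul_pos (inv_pos.2 (norm_pos_iff.2 (h.gradient_ne x hx.2))) (hm x hx.2)
  have hproj := map_hyperplaneProj_surface hm1
    (isClosed_frontier.measurableSet.inter h.isOpen.measurableSet) hcont
    (fun y hy => by rw [h.extNormal_eq hΩ hy, h.norm_unitGradient hy.2]) hpos
    (fun y hy ε hε => h.exists_chord_bound hΩ hy hε) (by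
      intro y₁ h₁ y₂ h₂ heq
      have heq' := congrArg (Subtype.val) heq
      rw [coe_hyperplaneProj hm1, coe_hyperplaneProj hm1] at heq'
      have key : ∀ z₁ ∈ frontier Ω ∩ U, ∀ z₂ ∈ frontier Ω ∩ U, ∀ s > (0 : ℝ), z₂ ≠ z₁ - s • m := by
        intro z₁ hz₁ z₂ hz₂ s hs hz
        have h3 := hbelow z₁ ⟨frontier_subset_closure hz₁.1, hz₁.2⟩ s hs (hz ▸ hz₂.2)
        have h4 := hz₂.1
        rw [hΩ.frontier_eq, hz] at h4
        exact h4.2 h3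
      rcases lt_trichotomy ⟪m, y₁⟫ ⟪m, y₂⟫ with hlt | he | hlt
      · refine absurd ?_ (key y₂ h₂ y₁ h₁ (⟪m, y₂⟫ - ⟪m, y₁⟫) (sub_pos.2 hlt))
        rw [sub_smul, sub_sub_eq_add_sub, add_sub_right_comm, ← heq', sub_add_cancel]
      · rw [he] at heq'
        exact sub_left_injective heq'
      · refine absurd ?_ (key y₁ h₁ y₂ h₂ (⟪m, y₁⟫ - ⟪m, y₂⟫) (sub_pos.2 hlt))
        rw [sub_smul, sub_sub_eq_add_sub, add_sub_right_comm, heq', sub_add_cancel])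
  exact ⟨hm1, h.isOpen, hbelow, hcont, hpos, hproj.2, hproj.1⟩

end IsDefiningOn

/-- The local defining functions, on balls so small that the gradient is almost constant. -/
theorem NeumannIdentity.HasC2Boundary.exists_isDefiningOn (h : HasC2Boundary Ω)
    {x₀ : EuclideanSpace ℝ (Fin N)} (hx₀ : x₀ ∈ frontier Ω) :
    ∃ φ : EuclideanSpace ℝ (Fin N) → ℝ, ∃ r > 0, IsDefiningOn Ω (Metric.ball x₀ r) φ ∧
      ∀ y ∈ Metric.ball x₀ r, ‖gradient φ y - gradient φ x₀‖ < ‖gradient φ x₀‖ / 2 := by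
  obtain ⟨φ, hφ, hne, hiff⟩ := h x₀ hx₀
  obtain ⟨u, hu, hφu⟩ := hφ.contDiffOn (m := 2) le_rfl (by simp)
  have hc : ContinuousAt (gradient φ) x₀ := by
    have h1 : ContinuousAt (fderiv ℝ φ) x₀ := (hφ.fderiv_right (m := 1) (by norm_num)).continuousAt
    exact (InnerProductSpace.toDual ℝ
      (EuclideanSpace ℝ (Fin N))).symm.continuous.continuousAt.comp h1
  have hg : gradient φ x₀ ≠ 0 := by
    simpa [gradient] using hne
  have hclose : ∀ᶠ y in 𝓝 x₀, ‖gradient φ y - gradient φ x₀‖ < ‖gradient φ x₀‖ / 2 := by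
    have : ContinuousAt (fun y => ‖gradient φ y - gradient φ x₀‖) x₀ :=
      (hc.sub continuousAt_const).norm
    refine this.eventually_lt_const ?_
    simpa using hg
  obtain ⟨r, hr, hball⟩ := Metric.eventually_nhds_iff_ball.1 ((hiff.and hclose).and
    (show ∀ᶠ y in 𝓝 x₀, y ∈ u from hu))
  refine ⟨φ, r, hr, ⟨Metric.isOpen_ball, hφu.mono fun y hy => (hball y hy).2,
    fun y hy => (hball y hy).1.1, fun y hy h0 => ?_⟩, fun y hy => (hball y hy).1.2⟩
  have h2 := (hball y hy).1.2
  rw [h0, zero_sub, norm_neg] at h2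
  have := norm_nonneg (gradient φ x₀)
  linarith

/-- Every point of the closure of `Ω` has a bounded neighbourhood which is an adapted box for all
unit vectors in some open cone of directions. -/
theorem NeumannIdentity.HasC2Boundary.exists_isAdaptedBox (h : HasC2Boundary Ω) (hΩ : IsOpen Ω)
    {x₀ : EuclideanSpace ℝ (Fin N)} (hN : 0 < N) (hx₀ : x₀ ∈ closure Ω) :
    ∃ r > 0, ∃ n : EuclideanSpace ℝ (Fin N), ‖n‖ = 1 ∧
      ∀ m : EuclideanSpace ℝ (Fin N), ‖m‖ = 1 → 1 / 2 < ⟪n, m⟫ →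
        IsAdaptedBox Ω (Metric.ball x₀ r) m (extNormal Ω) := by
  by_cases hx : x₀ ∈ Ω
  · obtain ⟨r, hr, hball⟩ := Metric.isOpen_iff.1 hΩ x₀ hx
    have hempty : frontier Ω ∩ Metric.ball x₀ r = ∅ := by
      rw [hΩ.frontier_eq, Set.eq_empty_iff_forall_notMem]
      exact fun y hy => hy.1.2 (hball hy.2)
    refine ⟨r, hr, EuclideanSpace.single ⟨0, hN⟩ 1, by simp, fun m hm _ => ?_⟩
    refine ⟨hm, Metric.isOpen_ball, fun x _ s _ hs => hball hs, ?_, ?_, ?_, ?_⟩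
    all_goals simp [hempty]
  · have hfr : x₀ ∈ frontier Ω := by rw [hΩ.frontier_eq]; exact ⟨hx₀, hx⟩
    obtain ⟨φ, r, hr, hφ, hclose⟩ := h.exists_isDefiningOn hfr
    have hx₀b := Metric.mem_ball_self (x := x₀) hr
    refine ⟨r, hr, unitGradient φ x₀, hφ.norm_unitGradient hx₀b, fun m hm hnm => ?_⟩
    refine hφ.isAdaptedBox hΩ (convex_ball x₀ r) hm fun y hy => ?_
    have hg := norm_pos_iff.2 (hφ.gradient_ne x₀ hx₀b)
    rw [unitGradient, inner_smul_left, conj_trivial, lt_inv_mul_iff₀ hg] at hnm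
    have h1 : ⟪gradient φ y, m⟫ = ⟪gradient φ x₀, m⟫ + ⟪gradient φ y - gradient φ x₀, m⟫ := by
      rw [inner_sub_left]; ring
    have h2 := neg_le_of_abs_le (abs_real_inner_le_norm (gradient φ y - gradient φ x₀) m)
    rw [hm, mul_one] at h2
    have := hclose y hy
    linarith

end DefiningFunction

/-! ### The normal field and the surface measure -/

section Domain

variable {N : ℕ} {Ω : Set (EuclideanSpace ℝ (Fin N))}

theorem NeumannIdentity.HasC2Boundary.isExteriorUnitNormal (h : HasC2Boundary Ω) (hΩ : IsOpen Ω)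
    {x : EuclideanSpace ℝ (Fin N)} (hx : x ∈ frontier Ω) :
    IsExteriorUnitNormal Ω x (extNormal Ω x) := by
  obtain ⟨φ, r, hr, hφ, -⟩ := h.exists_isDefiningOn hx
  have hxb := Metric.mem_ball_self (x := x) hr
  rw [hφ.extNormal_eq hΩ ⟨hx, hxb⟩]
  exact hφ.isExteriorUnitNormal hxb ((hφ.mem_frontier_iff hΩ hxb).1 hx)

theorem NeumannIdentity.HasC2Boundary.continuousOn_extNormal (h : HasC2Boundary Ω)
    (hΩ : IsOpen Ω) : ContinuousOn (extNormal Ω) (frontier Ω) := by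
  intro x hx
  obtain ⟨φ, r, hr, hφ, -⟩ := h.exists_isDefiningOn hx
  have hxb := Metric.ball_mem_nhds x hr
  have h1 : ContinuousWithinAt (extNormal Ω) (frontier Ω ∩ Metric.ball x r) x :=
    ((hφ.contDiffOn_unitGradient.continuousOn.mono Set.inter_subset_right).congr
      fun y hy => hφ.extNormal_eq hΩ hy) x ⟨hx, mem_of_mem_nhds hxb⟩
  rwa [continuousWithinAt_inter hxb] at h1

/-- Derivatives relative to the closure are unique up to the boundary, since the open half space of
inward directions consists of tangent directions. -/
theorem NeumannIdentity.HasC2Boundary.uniqueDiffOn_closure (h : HasC2Boundary Ω)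
    (hΩ : IsOpen Ω) : UniqueDiffOn ℝ (closure Ω) := by
  intro x hx
  by_cases hxΩ : x ∈ Ω
  · exact uniqueDiffWithinAt_of_mem_nhds (mem_of_superset (hΩ.mem_nhds hxΩ) subset_closure)
  have hn := h.isExteriorUnitNormal hΩ (x := x) (by rw [hΩ.frontier_eq]; exact ⟨hx, hxΩ⟩)
  refine ⟨?_, subset_closure hx⟩
  set C : Set (EuclideanSpace ℝ (Fin N)) := {v | ⟪v, extNormal Ω x⟫ < 0} with hC
  have hCo : IsOpen C := isOpen_lt (by fun_prop) continuous_const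
  have hsub : C ⊆ tangentConeAt ℝ (closure Ω) x := fun v hv =>
    mem_tangentConeAt_of_add_smul_mem (l := 𝓝[>] (0 : ℝ)) (nhdsGT_le_nhdsNE 0)
      ((hn.2.1 v hv).mono fun t ht => subset_closure ht)
  have hmem : -extNormal Ω x ∈ C := by
    simp [hC, inner_neg_left, hn.1]
  have htop : Submodule.span ℝ (tangentConeAt ℝ (closure Ω) x) = ⊤ := by
    refine Submodule.eq_top_of_nonempty_interior' _ ⟨-extNormal Ω x, ?_⟩
    exact mem_interior.2 ⟨C, hsub.trans Submodule.subset_span, hCo, hmem⟩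
  rw [htop]
  exact dense_univ

theorem finrank_orthogonal_unit {m : EuclideanSpace ℝ (Fin N)} (hm : ‖m‖ = 1) :
    Module.finrank ℝ (ℝ ∙ m)ᗮ = N - 1 := by
  have h1 := (ℝ ∙ m).finrank_add_finrank_orthogonal
  have hm0 : m ≠ 0 := fun h => by simp [h] at hm
  rw [finrank_span_singleton hm0, finrank_euclideanSpace_fin] at h1
  omega

/-- By the area formula, a piece of the boundary on which `⟪n, ν⟫ > c > 0` has at most `1 / c` times
the measure of its shadow. -/
theorem NeumannIdentity.HasC2Boundary.isFiniteMeasure_surfaceMeasure (h : HasC2Boundary Ω)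
    (hΩ : IsOpen Ω) (hb : Bornology.IsBounded Ω) (hN : 0 < N) :
    IsFiniteMeasure (surfaceMeasure Ω) := by
  have hΓ : IsCompact (frontier Ω) := hb.isCompact_closure.of_isClosed_subset isClosed_frontier
    frontier_subset_closure
  have hlt : Measure.euclideanHausdorffMeasure (N - 1) (frontier Ω) < ⊤ := by
    refine hΓ.measure_lt_top_of_nhdsWithin fun x hx => ?_
    obtain ⟨r, hr, n, hn, hbox⟩ := h.exists_isAdaptedBox hΩ hN (frontier_subset_closure hx)
    have hB := hbox n hn (by rw [real_inner_self_eq_norm_sq, hn]; norm_num)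
    have hball := Metric.ball_mem_nhds x hr
    have hpos := hB.inner_pos x ⟨hx, mem_of_mem_nhds hball⟩
    set S := frontier Ω ∩ Metric.ball x r with hS
    have hSm : MeasurableSet S := isClosed_frontier.measurableSet.inter measurableSet_ball
    set c := ⟪n, extNormal Ω x⟫ / 2 with hc
    have hev : ∀ᶠ y in 𝓝[frontier Ω] x, c < ⟪n, extNormal Ω y⟫ := by
      have h1 : ContinuousWithinAt (fun y => ⟪n, extNormal Ω y⟫) (frontier Ω) x :=
        continuousWithinAt_const.inner ((h.continuousOn_extNormal hΩ) x hx)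
      exact h1.eventually_const_lt (by simp only [hc]; linarith)
    have hSev : ∀ᶠ y in 𝓝[frontier Ω] x, y ∈ S :=
      inter_mem self_mem_nhdsWithin (mem_nhdsWithin_of_mem_nhds hball)
    refine ⟨{y | c < ⟪n, extNormal Ω y⟫ ∧ y ∈ S}, hev.and hSev, ?_⟩
    have hfin : volume (hyperplaneProj n '' S) < ⊤ := by
      refine Bornology.IsBounded.measure_lt_top ?_
      refine (hyperplaneProj n).lipschitz.isBounded_image ?_
      exact Metric.isBounded_ball.subset Set.inter_subset_right
    have hmap := congrArg (fun μ => μ Set.univ) hB.map_proj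
    simp only [finrank_orthogonal_unit hn] at hmap
    rw [Measure.map_apply (hyperplaneProj n).continuous.measurable MeasurableSet.univ,
      Set.preimage_univ, withDensity_apply _ MeasurableSet.univ, Measure.restrict_univ,
      Measure.restrict_apply_univ] at hmap
    have hcpos : 0 < c := by simp only [hc]; linarith
    have h2 : ENNReal.ofReal c * Measure.euclideanHausdorffMeasure (N - 1)
        {y | c < ⟪n, extNormal Ω y⟫ ∧ y ∈ S} ≤ volume (hyperplaneProj n '' S) := by
      rw [← hmap, ← setLIntegral_const]
      have hmeas : AEMeasurable (fun y => ENNReal.ofReal ⟪n, extNormal Ω y⟫)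
          ((Measure.euclideanHausdorffMeasure (N - 1)).restrict S) :=
        ((continuousOn_const.inner hB.continuousOn).aemeasurable hSm).ennreal_ofReal
      refine le_trans (lintegral_mono_ae ?_) (lintegral_mono_set (fun y hy => hy.2))
      have hm' : MeasurableSet {y | c < ⟪n, extNormal Ω y⟫ ∧ y ∈ S} := by
        have : {y | c < ⟪n, extNormal Ω y⟫ ∧ y ∈ S} =
            S ∩ (fun y => ⟪n, extNormal Ω y⟫) ⁻¹' Set.Ioi c := by
          ext y; simp [and_comm]
        rw [this]
        obtain ⟨u, hu, hu'⟩ := (continuousOn_iff'.1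
          (continuousOn_const.inner hB.continuousOn)) (Set.Ioi c) isOpen_Ioi
        rw [Set.inter_comm S]
        erw [hu']
        exact hu.measurableSet.inter hSm
      filter_upwards [ae_restrict_mem hm'] with y hy
      exact ENNReal.ofReal_le_ofReal hy.1.le
    by_contra htop
    rw [not_lt, top_le_iff] at htop
    rw [htop, ENNReal.mul_top (ENNReal.ofReal_pos.2 hcpos).ne'] at h2
    exact absurd (h2.trans_lt hfin) (lt_irrefl _)
  constructor
  rw [surfaceMeasure, Measure.restrict_apply_univ]
  exact hlt

end Domain

/-! ### Averages along segments -/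

section Steklov

variable {V : Type*} [NormedAddCommGroup V] [NormedSpace ℝ V]

/-- The Steklov average of `β` at `x`, over the segment from `x` to `x - t • v`. -/
noncomputable def steklovAverage (t : ℝ) (v : V) (β : V → ℝ) (x : V) : ℝ :=
  t⁻¹ * ∫ s in (0 : ℝ)..t, β (x - s • v)

theorem continuous_steklovAverage {t : ℝ} {v : V} {β : V → ℝ} (hβ : Continuous β) :
    Continuous (steklovAverage t v β) := by
  refine continuous_const.mul ?_
  exact intervalIntegral.continuous_parametric_intervalIntegral_of_continuous'
    (f := fun x s => β (x - s • v)) (by fun_prop) 0 t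

theorem abs_steklovAverage_le {t : ℝ} (ht : 0 < t) {v : V} {β : V → ℝ} {B : ℝ}
    (hB : ∀ x, |β x| ≤ B) (x : V) : |steklovAverage t v β x| ≤ B := by
  have h1 := intervalIntegral.norm_integral_le_of_norm_le_const (a := 0) (b := t)
    (f := fun s => β (x - s • v)) (C := B) fun s _ => hB _
  rw [steklovAverage, abs_mul, abs_of_pos (inv_pos.2 ht), inv_mul_le_iff₀ ht]
  rw [sub_zero, abs_of_pos ht, Real.norm_eq_abs] at h1
  linarith

theorem tendsto_steklovAverage {v : V} {β : V → ℝ} (hβ : Continuous β) (x : V) :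
    Tendsto (fun t => steklovAverage t v β x) (𝓝[>] 0) (𝓝 (β x)) := by
  have hc : Continuous fun s : ℝ => β (x - s • v) := by fun_prop
  have h1 := (hc.integral_hasStrictDerivAt 0 0).hasDerivAt
  have h2 := hasDerivAt_iff_tendsto_slope.1 h1
  rw [zero_smul, sub_zero] at h2
  refine (h2.mono_left (nhdsGT_le_nhdsNE 0)).congr fun t => ?_
  rw [slope_def_field, steklovAverage, intervalIntegral.integral_same, sub_zero, sub_zero,
    div_eq_inv_mul]

/-- Averaging makes a continuous function differentiable in the direction of averaging. -/
theorem hasDerivAt_steklovAverage {t : ℝ} {v : V} {β : V → ℝ} (hβ : Continuous β) (x : V) :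
    HasDerivAt (fun r : ℝ => steklovAverage t v β (x + r • v))
      (t⁻¹ * (β x - β (x - t • v))) 0 := by
  have hc : Continuous fun s : ℝ => β (x + s • v) := by fun_prop
  have hP : ∀ r : ℝ, HasDerivAt (fun r : ℝ => ∫ s in (0 : ℝ)..r, β (x + s • v)) (β (x + r • v)) r :=
    fun r => (hc.integral_hasStrictDerivAt 0 r).hasDerivAt
  have h1 := (hP 0).sub ((hP (0 - t)).comp_sub_const 0 t)
  rw [zero_smul, add_zero, zero_sub, neg_smul, ← sub_eq_add_neg] at h1
  refine (h1.const_mul t⁻¹).congr_of_eventuallyEq (Eventually.of_forall fun r => ?_)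
  simp only [steklovAverage, Pi.sub_apply]
  congr 1
  rw [intervalIntegral.integral_interval_sub_left (hc.intervalIntegrable _ _)
    (hc.intervalIntegrable _ _)]
  have := intervalIntegral.integral_comp_sub_left (a := 0) (b := t)
    (fun s => β (x + s • v)) r
  rw [sub_zero] at this
  rw [← this]
  refine intervalIntegral.integral_congr fun s _ => ?_
  simp only [sub_smul]
  congr 1
  abel

theorem tendsto_integral_mul_steklovAverage [MeasurableSpace V] [BorelSpace V]
    [SecondCountableTopology V] {μ : Measure V} {f : V → ℝ} (hf : Integrable f μ) {v : V}
    {β : V → ℝ} (hβ : Continuous β) {B : ℝ} (hB : ∀ x, |β x| ≤ B) :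
    Tendsto (fun t => ∫ x, f x * steklovAverage t v β x ∂μ) (𝓝[>] 0) (𝓝 (∫ x, f x * β x ∂μ)) := by
  refine tendsto_integral_filter_of_dominated_convergence (fun x => |f x| * B) ?_ ?_ ?_ ?_
  · exact Eventually.of_forall fun t => hf.aestronglyMeasurable.mul
      (continuous_steklovAverage hβ).aestronglyMeasurable
  · filter_upwards [self_mem_nhdsWithin] with t ht
    refine Eventually.of_forall fun x => ?_
    rw [norm_mul, Real.norm_eq_abs, Real.norm_eq_abs]
    exact mul_le_mul_of_nonneg_left (abs_steklovAverage_le ht hB x) (abs_nonneg _)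
  · exact hf.abs.mul_const B
  · exact Eventually.of_forall fun x => (tendsto_steklovAverage hβ x).const_mul (f x)

end Steklov

/-! ### The antisymmetric Green identity near a boundary point -/

section Green

variable {N : ℕ} {Ω : Set (EuclideanSpace ℝ (Fin N))}

/-- The derivative of `a` in the direction `v`, relative to the closure of `Ω`. -/
noncomputable def dirDeriv (Ω : Set (EuclideanSpace ℝ (Fin N))) (v : EuclideanSpace ℝ (Fin N))
    (a : EuclideanSpace ℝ (Fin N) → ℝ) (x : EuclideanSpace ℝ (Fin N)) : ℝ :=
  fderivWithin ℝ a (closure Ω) x v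

theorem hasDerivAt_dirDeriv (hΩ : IsOpen Ω) {a : EuclideanSpace ℝ (Fin N) → ℝ}
    (ha : ContDiffOn ℝ 1 a (closure Ω)) {x : EuclideanSpace ℝ (Fin N)} (hx : x ∈ Ω)
    (v : EuclideanSpace ℝ (Fin N)) :
    HasDerivAt (fun s : ℝ => a (x + s • v)) (dirDeriv Ω v a x) 0 := by
  have hcl : closure Ω ∈ 𝓝 x := mem_of_superset (hΩ.mem_nhds hx) subset_closure
  have h1 : HasFDerivAt a (fderivWithin ℝ a (closure Ω) x) x :=
    ((ha.differentiableOn one_ne_zero) x (subset_closure hx)).hasFDerivWithinAt.hasFDerivAt hcl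
  have h2 : HasDerivAt (fun s : ℝ => x + s • v) v 0 := by
    simpa using ((hasDerivAt_id (0 : ℝ)).smul_const v).const_add x
  have h3 : HasFDerivAt a (fderivWithin ℝ a (closure Ω) x) (x + (0 : ℝ) • v) := by simpa using h1
  exact h3.comp_hasDerivAt 0 h2

theorem continuousOn_dirDeriv (hu : UniqueDiffOn ℝ (closure Ω))
    {a : EuclideanSpace ℝ (Fin N) → ℝ} (ha : ContDiffOn ℝ 1 a (closure Ω))
    (v : EuclideanSpace ℝ (Fin N)) : ContinuousOn (dirDeriv Ω v a) (closure Ω) :=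
  (ha.continuousOn_fderivWithin hu le_rfl).clm_apply continuousOn_const

/-- A continuous function on a compact set extends to a bounded continuous function. -/
theorem exists_bounded_extension {X : Type*} [TopologicalSpace X] [NormalSpace X] [T2Space X]
    {K : Set X} (hK : IsCompact K) {f : X → ℝ} (hf : ContinuousOn f K) :
    ∃ g : X → ℝ, Continuous g ∧ (∃ B, ∀ x, |g x| ≤ B) ∧ ∀ x ∈ K, g x = f x := by
  have : CompactSpace K := isCompact_iff_compactSpace.1 hK
  let f' : BoundedContinuousFunction K ℝ := BoundedContinuousFunction.mkOfCompact
    ⟨K.domRestrict f, continuousOn_iff_continuous_domRestrict.1 hf⟩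
  obtain ⟨g, -, hg⟩ := f'.exists_norm_eq_domRestrict_eq_of_closed hK.isClosed
  refine ⟨g, g.continuous, ⟨‖g‖, fun x => g.norm_coe_le_norm x⟩, fun x hx => ?_⟩
  have := DFunLike.congr_fun hg ⟨x, hx⟩
  exact this

/-- If `x` belongs to `K` and to the closure of `Ω`, small translations of `x` in the direction
`-v` stay in `Ω`. -/
theorem IsAdaptedBox.exists_forall_sub_smul_mem {U K : Set (EuclideanSpace ℝ (Fin N))}
    {v : EuclideanSpace ℝ (Fin N)} {ν} (hb : IsAdaptedBox Ω U v ν) (hK : IsCompact K)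
    (hKU : K ⊆ U) :
    ∃ δ > 0, ∀ x ∈ closure Ω, x ∈ Metric.thickening δ K → ∀ s ∈ Set.Ioo (0 : ℝ) δ,
      x - s • v ∈ Ω := by
  obtain ⟨δ, hδ, hsub⟩ := hK.exists_thickening_subset_open hb.isOpen hKU
  refine ⟨δ / 2, by linarith, fun x hx hxK s hs => ?_⟩
  obtain ⟨y, hy, hxy⟩ := Metric.mem_thickening_iff.1 hxK
  have hd : dist (x - s • v) x < δ / 2 := by
    rw [dist_eq_norm, sub_sub_cancel_left, norm_neg, norm_smul, hb.norm_eq, mul_one,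
      Real.norm_eq_abs, abs_of_pos hs.1]
    exact hs.2
  refine hb.mem_of_below x ⟨hx, hsub (Metric.mem_thickening_iff.2 ⟨y, hy, by linarith⟩)⟩ s hs.1
    (hsub (Metric.mem_thickening_iff.2 ⟨y, hy, ?_⟩))
  have := dist_triangle (x - s • v) x y
  linarith

/-- The Steklov average of a directional derivative is a difference quotient. -/
theorem steklovAverage_dirDeriv_eq (hΩ : IsOpen Ω) {b β : EuclideanSpace ℝ (Fin N) → ℝ}
    (hb : ContDiffOn ℝ 1 b (closure Ω)) {v : EuclideanSpace ℝ (Fin N)} (hβ : Continuous β)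
    (hβb : ∀ x ∈ closure Ω, β x = dirDeriv Ω v b x) {x : EuclideanSpace ℝ (Fin N)} {t : ℝ}
    (ht : 0 < t) (hx : x ∈ closure Ω) (hseg : ∀ s ∈ Set.Ioc 0 t, x - s • v ∈ Ω) :
    steklovAverage t v β x = t⁻¹ * (b x - b (x - t • v)) := by
  have hcl : ∀ s ∈ Set.Icc 0 t, x - s • v ∈ closure Ω := by
    intro s hs
    rcases hs.1.eq_or_lt with rfl | h
    · simpa using hx
    · exact subset_closure (hseg s ⟨h, hs.2⟩)
  have h1 : ∫ s in (0 : ℝ)..t, -β (x - s • v) = b (x - t • v) - b (x - (0 : ℝ) • v) := by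
    refine intervalIntegral.integral_eq_sub_of_hasDerivAt_of_le ht.le
      (f := fun s : ℝ => b (x - s • v)) ?_ ?_ ?_
    · exact hb.continuousOn.comp (by fun_prop) hcl
    · intro s hs
      have hs' := hseg s ⟨hs.1, hs.2.le⟩
      rw [hβb _ (subset_closure hs')]
      have h2 : HasDerivAt (fun r : ℝ => s - r) (-1) s := by
        simpa using (hasDerivAt_id s).const_sub s
      have h3 : HasDerivAt (fun r : ℝ => b (x - s • v + r • v)) (dirDeriv Ω v b (x - s • v))
          ((fun r : ℝ => s - r) s) := by
        beta_reduce
        rw [sub_self]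
        exact hasDerivAt_dirDeriv hΩ hb hs' v
      have h4 := HasDerivAt.comp (h := fun r : ℝ => s - r) s h3 h2
      rw [mul_neg_one] at h4
      refine h4.congr_of_eventuallyEq (Eventually.of_forall fun r => ?_)
      simp only [Function.comp]
      congr 1
      module
    · exact (Continuous.intervalIntegrable (by fun_prop) _ _)
  rw [intervalIntegral.integral_neg, zero_smul, sub_zero] at h1
  rw [steklovAverage]
  congr 1
  linarith

theorem NeumannIdentity.HasC2Boundary.integrable_surfaceMeasure (hC : HasC2Boundary Ω)
    (hΩ : IsOpen Ω) (hbdd : Bornology.IsBounded Ω) (hN : 0 < N)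
    {f : EuclideanSpace ℝ (Fin N) → ℝ} (hf : ContinuousOn f (frontier Ω)) :
    Integrable f (surfaceMeasure Ω) := by
  have hΓ : IsCompact (frontier Ω) := hbdd.isCompact_closure.of_isClosed_subset isClosed_frontier
    frontier_subset_closure
  have hlt := (hC.isFiniteMeasure_surfaceMeasure hΩ hbdd hN).measure_univ_lt_top
  rw [surfaceMeasure, Measure.restrict_apply_univ] at hlt
  obtain ⟨B, hB⟩ := hΓ.exists_bound_of_continuousOn hf
  exact IntegrableOn.of_bound hlt
    (hf.aestronglyMeasurable isClosed_frontier.measurableSet) B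
    ((ae_restrict_mem isClosed_frontier.measurableSet).mono fun x hx => hB x hx)

/-- The local form of `integral_dirDeriv_mul_sub_eq`, for directions which point out of `Ω`. -/
theorem integral_dirDeriv_mul_sub_eq_of_isAdaptedBox (hΩ : IsOpen Ω)
    (hbdd : Bornology.IsBounded Ω) (hC : HasC2Boundary Ω) (hN : 0 < N)
    {U K : Set (EuclideanSpace ℝ (Fin N))} {v w : EuclideanSpace ℝ (Fin N)}
    (hv : IsAdaptedBox Ω U v (extNormal Ω)) (hw : IsAdaptedBox Ω U w (extNormal Ω))
    (hK : IsCompact K) (hKU : K ⊆ U) {a b : EuclideanSpace ℝ (Fin N) → ℝ}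
    (ha : ContDiffOn ℝ 1 a (closure Ω)) (hb : ContDiffOn ℝ 1 b (closure Ω))
    (haK : ∀ x ∉ K, a x = 0) :
    ∫ x in Ω, (dirDeriv Ω v a x * dirDeriv Ω w b x - dirDeriv Ω w a x * dirDeriv Ω v b x) =
      ∫ x, a x * (dirDeriv Ω w b x * ⟪v, extNormal Ω x⟫ - dirDeriv Ω v b x * ⟪w, extNormal Ω x⟫)
        ∂(surfaceMeasure Ω) := by
  have hcpt := hbdd.isCompact_closure
  have huniq := hC.uniqueDiffOn_closure hΩ
  have hintΩ : ∀ f : EuclideanSpace ℝ (Fin N) → ℝ, ContinuousOn f (closure Ω) →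
      IntegrableOn f Ω := fun f hf => (hf.integrableOn_compact hcpt).mono_set subset_closure
  have hintΓ : ∀ f : EuclideanSpace ℝ (Fin N) → ℝ, ContinuousOn f (frontier Ω) →
      Integrable f (surfaceMeasure Ω) := fun f hf =>
    hC.integrable_surfaceMeasure hΩ hbdd hN hf
  obtain ⟨βv, hβv, ⟨Bv, hBv⟩, hβvb⟩ := exists_bounded_extension hcpt
    (continuousOn_dirDeriv huniq hb v)
  obtain ⟨βw, hβw, ⟨Bw, hBw⟩, hβwb⟩ := exists_bounded_extension hcpt
    (continuousOn_dirDeriv huniq hb w)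
  obtain ⟨δ, hδ, hshift⟩ := hw.exists_forall_sub_smul_mem hK hKU
  have hνc := hC.continuousOn_extNormal hΩ
  have haΓ := ha.continuousOn.mono (frontier_subset_closure (s := Ω))
  have hav := continuousOn_dirDeriv huniq ha v
  have haw := continuousOn_dirDeriv huniq ha w
  have hbv := continuousOn_dirDeriv huniq hb v
  have hbw := continuousOn_dirDeriv huniq hb w
  have hzero : ∀ e : EuclideanSpace ℝ (Fin N), ∀ x ∈ Ω, x ∉ K → dirDeriv Ω e a x = 0 :=
    fun e x hx hxK => eq_zero_of_hasDerivAt_line_of_notMem hK.isClosed haK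
      (fun y hy => hasDerivAt_dirDeriv hΩ ha hy e) hx hxK
  -- For the averaged derivatives, which are differentiable in the transversal directions with
  -- equal mixed derivatives, the identity is the difference of two divergence theorems.
  have hmain : ∀ t ∈ Set.Ioo (0 : ℝ) δ,
      (∫ x in Ω, dirDeriv Ω v a x * steklovAverage t w βw x) -
        (∫ x in Ω, dirDeriv Ω w a x * steklovAverage t w βv x) =
      (∫ x, a x * ⟪v, extNormal Ω x⟫ * steklovAverage t w βw x ∂(surfaceMeasure Ω)) -
        (∫ x, a x * ⟪w, extNormal Ω x⟫ * steklovAverage t w βv x ∂(surfaceMeasure Ω)) := by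
    intro t ht
    have hsw := continuous_steklovAverage (t := t) (v := w) hβw
    have hsv := continuous_steklovAverage (t := t) (v := w) hβv
    have hmixed : Continuous fun x => t⁻¹ * (βv x - βv (x - t • w)) := by fun_prop
    have i0 : IntegrableOn (fun x => a x * (t⁻¹ * (βv x - βv (x - t • w)))) Ω :=
      hintΩ _ (ha.continuousOn.mul hmixed.continuousOn)
    have i1 : IntegrableOn (fun x => dirDeriv Ω v a x * steklovAverage t w βw x) Ω :=
      hintΩ _ (hav.mul hsw.continuousOn)
    have i2 : IntegrableOn (fun x => dirDeriv Ω w a x * steklovAverage t w βv x) Ω :=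
      hintΩ _ (haw.mul hsv.continuousOn)
    have hmem : ∀ x ∈ closure Ω, x ∈ Metric.thickening δ K → ∀ s ∈ Set.Ioc 0 t, x - s • w ∈ Ω :=
      fun x hx hxK s hs => hshift x hx hxK s ⟨hs.1, hs.2.trans_lt ht.2⟩
    have h1 := hv.integral_lineDeriv (F := fun x => a x * steklovAverage t w βw x)
      (F' := fun x => dirDeriv Ω v a x * steklovAverage t w βw x +
        a x * (t⁻¹ * (βv x - βv (x - t • w)))) hΩ hK hKU
      (fun x hx => by simp [haK x hx]) (ha.continuousOn.mul hsw.continuousOn) (by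
        intro x hx
        have hline : ContinuousAt (fun r : ℝ => x + r • v) 0 := by fun_prop
        by_cases hxK : x ∈ K
        · have hxt : x ∈ Metric.thickening δ K := Metric.self_subset_thickening hδ K hxK
          have hxt' : x - t • w ∈ Ω := hmem x (subset_closure hx) hxt t ⟨ht.1, le_rfl⟩
          have hd1 := hasDerivAt_dirDeriv hΩ hb hx v
          have hd2 := hasDerivAt_dirDeriv hΩ hb hxt' v
          rw [← hβvb x (subset_closure hx)] at hd1
          rw [← hβvb _ (subset_closure hxt')] at hd2
          have hd3 : HasDerivAt (fun r : ℝ => steklovAverage t w βw (x + r • v))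
              (t⁻¹ * (βv x - βv (x - t • w))) 0 := by
            refine ((hd1.sub hd2).const_mul t⁻¹).congr_of_eventuallyEq ?_
            have e1 : ∀ᶠ r : ℝ in 𝓝 0, x + r • v ∈ Ω :=
              hline.eventually_mem (by simpa using hΩ.mem_nhds hx)
            have e2 : ∀ᶠ r : ℝ in 𝓝 0, x + r • v ∈ Metric.thickening δ K :=
              hline.eventually_mem (by simpa using Metric.isOpen_thickening.mem_nhds hxt)
            filter_upwards [e1, e2] with r hr1 hr2
            rw [steklovAverage_dirDeriv_eq hΩ hb hβw hβwb ht.1 (subset_closure hr1)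
              (hmem _ (subset_closure hr1) hr2)]
            simp only [Pi.sub_apply]
            rw [sub_add_eq_add_sub]
          have := (hasDerivAt_dirDeriv hΩ ha hx v).fun_mul hd3
          simpa using this
        · have : dirDeriv Ω v a x * steklovAverage t w βw x +
              a x * (t⁻¹ * (βv x - βv (x - t • w))) = 0 := by
            rw [hzero v x hx hxK, haK x hxK]; ring
          rw [this]
          refine (hasDerivAt_const (0 : ℝ) (0 : ℝ)).congr_of_eventuallyEq ?_
          filter_upwards [hline.eventually_mem
            (by simpa using hK.isClosed.isOpen_compl.mem_nhds hxK)] with r hr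
          rw [haK _ hr, zero_mul])
      (i1.add i0)
    have h2 := hw.integral_lineDeriv (F := fun x => a x * steklovAverage t w βv x)
      (F' := fun x => dirDeriv Ω w a x * steklovAverage t w βv x +
        a x * (t⁻¹ * (βv x - βv (x - t • w)))) hΩ hK hKU
      (fun x hx => by simp [haK x hx]) (ha.continuousOn.mul hsv.continuousOn) (by
        intro x hx
        have := (hasDerivAt_dirDeriv hΩ ha hx w).fun_mul (hasDerivAt_steklovAverage (t := t)
          (v := w) hβv x)
        simpa using this)
      (i2.add i0)
    rw [integral_add i1 i0, finrank_orthogonal_unit hv.norm_eq] at h1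
    rw [integral_add i2 i0, finrank_orthogonal_unit hw.norm_eq] at h2
    have e1 : ∀ (β : EuclideanSpace ℝ (Fin N) → ℝ) (e : EuclideanSpace ℝ (Fin N)),
        ∫ x, a x * ⟪e, extNormal Ω x⟫ * steklovAverage t w β x ∂(surfaceMeasure Ω) =
        ∫ x in frontier Ω, a x * steklovAverage t w β x * ⟪e, extNormal Ω x⟫
          ∂(Measure.euclideanHausdorffMeasure (N - 1)) := fun β e => by
      rw [surfaceMeasure]
      congr 1
      ext x
      ring
    rw [e1, e1, ← h1, ← h2]
    ring
  have hI1 : Integrable (fun x => a x * ⟪v, extNormal Ω x⟫) (surfaceMeasure Ω) :=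
    hintΓ _ (haΓ.mul (continuousOn_const.inner hνc))
  have hI2 : Integrable (fun x => a x * ⟪w, extNormal Ω x⟫) (surfaceMeasure Ω) :=
    hintΓ _ (haΓ.mul (continuousOn_const.inner hνc))
  have hlim1 := (tendsto_integral_mul_steklovAverage (hintΩ _ hav) (v := w) hβw hBw).sub
    (tendsto_integral_mul_steklovAverage (hintΩ _ haw) (v := w) hβv hBv)
  have hlim2 := (tendsto_integral_mul_steklovAverage hI1 (v := w) hβw hBw).sub
    (tendsto_integral_mul_steklovAverage hI2 (v := w) hβv hBv)
  have heq := tendsto_nhds_unique_of_eventuallyEq hlim1 hlim2 (by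
    filter_upwards [Ioo_mem_nhdsGT hδ] with t ht using hmain t ht)
  have hL : ∀ f β : EuclideanSpace ℝ (Fin N) → ℝ, ∀ e : EuclideanSpace ℝ (Fin N),
      (∀ x ∈ closure Ω, β x = dirDeriv Ω e b x) →
      ∫ x in Ω, f x * β x = ∫ x in Ω, f x * dirDeriv Ω e b x := fun f β e hβ =>
    setIntegral_congr_fun hΩ.measurableSet fun x hx => by
      simp only [hβ x (subset_closure hx)]
  have hR : ∀ f β : EuclideanSpace ℝ (Fin N) → ℝ, ∀ e : EuclideanSpace ℝ (Fin N),
      (∀ x ∈ closure Ω, β x = dirDeriv Ω e b x) →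
      ∫ x, f x * β x ∂(surfaceMeasure Ω) = ∫ x, f x * dirDeriv Ω e b x ∂(surfaceMeasure Ω) :=
    fun f β e hβ => setIntegral_congr_fun isClosed_frontier.measurableSet fun x hx => by
      simp only [hβ x (frontier_subset_closure hx)]
  have i1 : IntegrableOn (fun x => dirDeriv Ω v a x * dirDeriv Ω w b x) Ω := hintΩ _ (hav.mul hbw)
  have i2 : IntegrableOn (fun x => dirDeriv Ω w a x * dirDeriv Ω v b x) Ω := hintΩ _ (haw.mul hbv)
  have i3 : Integrable (fun x => a x * ⟪v, extNormal Ω x⟫ * dirDeriv Ω w b x)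
      (surfaceMeasure Ω) := hintΓ _
    ((haΓ.mul (continuousOn_const.inner hνc)).mul (hbw.mono frontier_subset_closure))
  have i4 : Integrable (fun x => a x * ⟪w, extNormal Ω x⟫ * dirDeriv Ω v b x)
      (surfaceMeasure Ω) := hintΓ _
    ((haΓ.mul (continuousOn_const.inner hνc)).mul (hbv.mono frontier_subset_closure))
  rw [hL _ _ w hβwb, hL _ _ v hβvb, hR _ _ w hβwb, hR _ _ v hβvb, ← integral_sub i1 i2,
    ← integral_sub i3 i4] at heq
  rw [heq]
  congr 1
  ext x
  ring

end Green

/-! ### The antisymmetric Green identity -/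

section GlobalGreen

variable {N : ℕ} {Ω : Set (EuclideanSpace ℝ (Fin N))}

/-- The directions in which a neighbourhood of a boundary point is an adapted box span the space. -/
theorem span_cone_eq_top {V : Type*} [NormedAddCommGroup V] [InnerProductSpace ℝ V] {n : V}
    (hn : ‖n‖ = 1) : Submodule.span ℝ {m : V | ‖m‖ = 1 ∧ 1 / 2 < ⟪n, m⟫} = ⊤ := by
  refine Submodule.eq_top_of_nonempty_interior' _ ⟨n, ?_⟩
  refine mem_interior.2 ⟨{m : V | ‖m‖ / 2 < ⟪n, m⟫}, fun m hm => ?_,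
    isOpen_lt (by fun_prop) (by fun_prop), ?_⟩
  · have hm0 : 0 < ‖m‖ := by
      rcases (norm_nonneg m).eq_or_lt with h | h
      · rw [eq_comm, norm_eq_zero] at h
        subst h
        simp at hm
      · exact h
    have h1 : m = ‖m‖ • (‖m‖⁻¹ • m) := by rw [smul_smul, mul_inv_cancel₀ hm0.ne', one_smul]
    rw [h1]
    refine Submodule.smul_mem _ _ (Submodule.subset_span ⟨?_, ?_⟩)
    · rw [norm_smul, norm_inv, norm_norm, inv_mul_cancel₀ hm0.ne']
    · rw [inner_smul_right, lt_inv_mul_iff₀ hm0]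
      have : ‖m‖ / 2 < ⟪n, m⟫ := hm
      linarith
  · simp only [Set.mem_ofPred_eq, hn, real_inner_self_eq_norm_sq]
    norm_num

theorem dirDeriv_add_left (v₁ v₂ : EuclideanSpace ℝ (Fin N)) (a : EuclideanSpace ℝ (Fin N) → ℝ)
    (x : EuclideanSpace ℝ (Fin N)) :
    dirDeriv Ω (v₁ + v₂) a x = dirDeriv Ω v₁ a x + dirDeriv Ω v₂ a x := map_add _ _ _

theorem dirDeriv_smul_left (c : ℝ) (v : EuclideanSpace ℝ (Fin N))
    (a : EuclideanSpace ℝ (Fin N) → ℝ) (x : EuclideanSpace ℝ (Fin N)) :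
    dirDeriv Ω (c • v) a x = c * dirDeriv Ω v a x := map_smul _ _ _

/-- The property of two directions `v`, `w` that the antisymmetric Green identity holds for the
functions `a`, `b` in these directions. -/
def GreenIdentity (Ω : Set (EuclideanSpace ℝ (Fin N))) (a b : EuclideanSpace ℝ (Fin N) → ℝ)
    (v w : EuclideanSpace ℝ (Fin N)) : Prop :=
  ∫ x in Ω, (dirDeriv Ω v a x * dirDeriv Ω w b x - dirDeriv Ω w a x * dirDeriv Ω v b x) =
    ∫ x, a x * (dirDeriv Ω w b x * ⟪v, extNormal Ω x⟫ - dirDeriv Ω v b x * ⟪w, extNormal Ω x⟫)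
      ∂(surfaceMeasure Ω)

theorem GreenIdentity.swap {a b : EuclideanSpace ℝ (Fin N) → ℝ} {v w : EuclideanSpace ℝ (Fin N)}
    (h : GreenIdentity Ω a b v w) : GreenIdentity Ω a b w v := by
  have h' := congrArg Neg.neg h
  rw [← integral_neg, ← integral_neg] at h'
  refine Eq.trans (integral_congr_ae (Eventually.of_forall fun x => ?_)) (h'.trans
    (integral_congr_ae (Eventually.of_forall fun x => ?_)))
  · simp only; ring
  · simp only; ring

theorem integrableOn_of_continuousOn_closure (hbdd : Bornology.IsBounded Ω)
    {f : EuclideanSpace ℝ (Fin N) → ℝ} (hf : ContinuousOn f (closure Ω)) : IntegrableOn f Ω :=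
  (hf.integrableOn_compact hbdd.isCompact_closure).mono_set subset_closure

theorem continuousOn_green_bulk (hΩ : IsOpen Ω) (hC : HasC2Boundary Ω)
    {a b : EuclideanSpace ℝ (Fin N) → ℝ} (ha : ContDiffOn ℝ 1 a (closure Ω))
    (hb : ContDiffOn ℝ 1 b (closure Ω)) (v w : EuclideanSpace ℝ (Fin N)) :
    ContinuousOn (fun x => dirDeriv Ω v a x * dirDeriv Ω w b x -
      dirDeriv Ω w a x * dirDeriv Ω v b x) (closure Ω) := by
  have hu := hC.uniqueDiffOn_closure hΩ
  exact ((continuousOn_dirDeriv hu ha v).mul (continuousOn_dirDeriv hu hb w)).sub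
    ((continuousOn_dirDeriv hu ha w).mul (continuousOn_dirDeriv hu hb v))

theorem continuousOn_green_boundary (hΩ : IsOpen Ω) (hC : HasC2Boundary Ω)
    {a b : EuclideanSpace ℝ (Fin N) → ℝ} (ha : ContDiffOn ℝ 1 a (closure Ω))
    (hb : ContDiffOn ℝ 1 b (closure Ω)) (v w : EuclideanSpace ℝ (Fin N)) :
    ContinuousOn (fun x => a x * (dirDeriv Ω w b x * ⟪v, extNormal Ω x⟫ -
      dirDeriv Ω v b x * ⟪w, extNormal Ω x⟫)) (frontier Ω) := by
  have hu := hC.uniqueDiffOn_closure hΩ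
  have hν := hC.continuousOn_extNormal hΩ
  have hsub := frontier_subset_closure (s := Ω)
  exact (ha.continuousOn.mono hsub).mul
    ((((continuousOn_dirDeriv hu hb w).mono hsub).mul (continuousOn_const.inner hν)).sub
    (((continuousOn_dirDeriv hu hb v).mono hsub).mul (continuousOn_const.inner hν)))

/-- The directions for which the Green identity holds form a subspace. -/
theorem greenIdentity_of_mem_span (hΩ : IsOpen Ω) (hbdd : Bornology.IsBounded Ω)
    (hC : HasC2Boundary Ω) (hN : 0 < N) {a b : EuclideanSpace ℝ (Fin N) → ℝ}
    (ha : ContDiffOn ℝ 1 a (closure Ω)) (hb : ContDiffOn ℝ 1 b (closure Ω))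
    {C : Set (EuclideanSpace ℝ (Fin N))} {w : EuclideanSpace ℝ (Fin N)}
    (h : ∀ v ∈ C, GreenIdentity Ω a b v w) {v : EuclideanSpace ℝ (Fin N)}
    (hv : v ∈ Submodule.span ℝ C) : GreenIdentity Ω a b v w := by
  induction hv using Submodule.span_induction with
  | mem v hv => exact h v hv
  | zero =>
    have h0 : ∀ f : EuclideanSpace ℝ (Fin N) → ℝ, ∀ x, dirDeriv Ω 0 f x = 0 := fun f x => map_zero _
    simp [GreenIdentity, h0]
  | add v₁ v₂ _ _ h₁ h₂ =>
    have e := congrArg₂ (· + ·) h₁ h₂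
    rw [← integral_add (integrableOn_of_continuousOn_closure hbdd
        (continuousOn_green_bulk hΩ hC ha hb v₁ w)) (integrableOn_of_continuousOn_closure hbdd
        (continuousOn_green_bulk hΩ hC ha hb v₂ w)),
      ← integral_add
        (hC.integrable_surfaceMeasure hΩ hbdd hN (continuousOn_green_boundary hΩ hC ha hb v₁ w))
        (hC.integrable_surfaceMeasure hΩ hbdd hN (continuousOn_green_boundary hΩ hC ha hb v₂ w))]
      at e
    refine Eq.trans (integral_congr_ae (Eventually.of_forall fun x => ?_)) (e.trans
      (integral_congr_ae (Eventually.of_forall fun x => ?_)))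
    · simp only [dirDeriv_add_left]; ring
    · simp only [dirDeriv_add_left, inner_add_left]; ring
  | smul c v _ hv =>
    have e := congrArg (c * ·) hv
    rw [← integral_const_mul, ← integral_const_mul] at e
    refine Eq.trans (integral_congr_ae (Eventually.of_forall fun x => ?_)) (e.trans
      (integral_congr_ae (Eventually.of_forall fun x => ?_)))
    · simp only [dirDeriv_smul_left]; ring
    · simp only [dirDeriv_smul_left, inner_smul_left, conj_trivial]; ring

theorem dirDeriv_sum (hu : UniqueDiffOn ℝ (closure Ω)) {ι : Type*} {s : Finset ι}
    {a : EuclideanSpace ℝ (Fin N) → ℝ} {f : ι → EuclideanSpace ℝ (Fin N) → ℝ}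
    (hf : ∀ i ∈ s, ContDiffOn ℝ 1 (f i) (closure Ω)) (ha : ∀ x ∈ closure Ω, a x = ∑ i ∈ s, f i x)
    {x : EuclideanSpace ℝ (Fin N)} (hx : x ∈ closure Ω) (v : EuclideanSpace ℝ (Fin N)) :
    dirDeriv Ω v a x = ∑ i ∈ s, dirDeriv Ω v (f i) x := by
  simp only [dirDeriv]
  rw [fderivWithin_congr ha (ha x hx), fderivWithin_fun_sum (hu x hx) fun i hi =>
    (hf i hi).differentiableOn one_ne_zero x hx, sum_apply]

/-- **Antisymmetric Green identity**, for functions which are `C¹` up to the boundary. For functions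
of class `C²` it follows from the divergence theorem, since mixed derivatives commute. -/
theorem integral_dirDeriv_mul_sub_eq (hΩ : IsOpen Ω) (hbdd : Bornology.IsBounded Ω)
    (hC : HasC2Boundary Ω) (hN : 0 < N) {a b : EuclideanSpace ℝ (Fin N) → ℝ}
    (ha : ContDiffOn ℝ 1 a (closure Ω)) (hb : ContDiffOn ℝ 1 b (closure Ω))
    (v w : EuclideanSpace ℝ (Fin N)) :
    ∫ x in Ω, (dirDeriv Ω v a x * dirDeriv Ω w b x - dirDeriv Ω w a x * dirDeriv Ω v b x) =
      ∫ x, a x * (dirDeriv Ω w b x * ⟪v, extNormal Ω x⟫ - dirDeriv Ω v b x * ⟪w, extNormal Ω x⟫)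
        ∂(surfaceMeasure Ω) := by
  have hu := hC.uniqueDiffOn_closure hΩ
  have hbox : ∀ x : closure Ω, _ := fun x => hC.exists_isAdaptedBox hΩ hN x.2
  choose r hr n hn hbox using hbox
  obtain ⟨t, ht⟩ := hbdd.isCompact_closure.elim_finite_subcover
    (fun x : closure Ω => Metric.ball (x : EuclideanSpace ℝ (Fin N)) (r x))
    (fun x => Metric.isOpen_ball) fun x hx => Set.mem_iUnion.2
      ⟨⟨x, hx⟩, Metric.mem_ball_self (hr _)⟩
  obtain ⟨f, hf⟩ := SmoothPartitionOfUnity.exists_isSubordinate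
    (modelWithCornersSelf ℝ (EuclideanSpace ℝ (Fin N))) (isClosed_closure (s := Ω))
    (fun i : t => Metric.ball (i.1 : EuclideanSpace ℝ (Fin N)) (r i))
    (fun i => Metric.isOpen_ball) (by
      intro x hx
      obtain ⟨i, hi, hxi⟩ := Set.mem_iUnion₂.1 (ht hx)
      exact Set.mem_iUnion.2 ⟨⟨i, hi⟩, hxi⟩)
  have hfa : ∀ i, ContDiffOn ℝ 1 (fun x => f i x * a x) (closure Ω) := fun i =>
    ((f i).contMDiff.contDiff.of_le (by simp)).contDiffOn.mul ha
  have hsum : ∀ x ∈ closure Ω, a x = ∑ i, f i x * a x := by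
    intro x hx
    have h1 := f.sum_eq_one hx
    rw [finsum_eq_sum_of_fintype] at h1
    rw [← Finset.sum_mul, h1, one_mul]
  have hlocal : ∀ i, GreenIdentity Ω (fun x => f i x * a x) b v w := by
    intro i
    have hcpt : IsCompact (tsupport (f i)) := Metric.isCompact_of_isClosed_isBounded
      (isClosed_tsupport _) (Metric.isBounded_ball.subset (hf i))
    have hmem : ∀ e : EuclideanSpace ℝ (Fin N),
        e ∈ Submodule.span ℝ {m | ‖m‖ = 1 ∧ 1 / 2 < ⟪n i, m⟫} := fun e => by
      rw [span_cone_eq_top (hn i)]; trivial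
    -- Both sides are bilinear in the two directions, so directions which point outwards suffice.
    refine greenIdentity_of_mem_span hΩ hbdd hC hN (hfa i) hb (fun v' hv' => ?_) (hmem v)
    refine GreenIdentity.swap ?_
    refine greenIdentity_of_mem_span hΩ hbdd hC hN (hfa i) hb (fun w' hw' => ?_) (hmem w)
    refine integral_dirDeriv_mul_sub_eq_of_isAdaptedBox hΩ hbdd hC hN (hbox i w' hw'.1 hw'.2)
      (hbox i v' hv'.1 hv'.2) hcpt (hf i) (hfa i) hb fun x hx => ?_
    rw [image_eq_zero_of_notMem_tsupport hx, zero_mul]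
  have e := Finset.sum_congr (rfl : (Finset.univ : Finset t) = Finset.univ) fun i _ => hlocal i
  rw [← integral_finsetSum _ fun i _ => integrableOn_of_continuousOn_closure hbdd
      (continuousOn_green_bulk hΩ hC (hfa i) hb v w),
    ← integral_finsetSum _ fun i _ => hC.integrable_surfaceMeasure hΩ hbdd hN
      (continuousOn_green_boundary hΩ hC (hfa i) hb v w)] at e
  refine Eq.trans ?_ (e.trans ?_)
  · refine setIntegral_congr_fun hΩ.measurableSet fun x hx => ?_
    rw [dirDeriv_sum hu (fun i _ => hfa i) hsum (subset_closure hx),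
      dirDeriv_sum hu (fun i _ => hfa i) hsum (subset_closure hx), Finset.sum_mul, Finset.sum_mul,
      Finset.sum_sub_distrib]
  · refine setIntegral_congr_fun isClosed_frontier.measurableSet fun x hx => ?_
    rw [← Finset.sum_mul, ← hsum x (frontier_subset_closure hx)]

end GlobalGreen

/-! ### The flux identity for two vector fields -/

section FluxPairs

variable {N : ℕ} {Ω : Set (EuclideanSpace ℝ (Fin N))}

/-- The trace of a continuous linear endomorphism. -/
noncomputable def ctrace (A : EuclideanSpace ℝ (Fin N) →L[ℝ] EuclideanSpace ℝ (Fin N)) : ℝ :=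
  LinearMap.trace ℝ (EuclideanSpace ℝ (Fin N)) A.toLinearMap

theorem ctrace_eq_sum (A : EuclideanSpace ℝ (Fin N) →L[ℝ] EuclideanSpace ℝ (Fin N)) :
    ctrace A = ∑ i, A (EuclideanSpace.single i 1) i := by
  rw [ctrace, LinearMap.trace_eq_sum_inner _ (EuclideanSpace.basisFun (Fin N) ℝ)]
  simp [EuclideanSpace.inner_single_left]

theorem ctrace_add (A B : EuclideanSpace ℝ (Fin N) →L[ℝ] EuclideanSpace ℝ (Fin N)) :
    ctrace (A + B) = ctrace A + ctrace B := by simp [ctrace_eq_sum, Finset.sum_add_distrib]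

theorem ctrace_sub (A B : EuclideanSpace ℝ (Fin N) →L[ℝ] EuclideanSpace ℝ (Fin N)) :
    ctrace (A - B) = ctrace A - ctrace B := by simp [ctrace_eq_sum, Finset.sum_sub_distrib]

theorem ctrace_smul (c : ℝ) (A : EuclideanSpace ℝ (Fin N) →L[ℝ] EuclideanSpace ℝ (Fin N)) :
    ctrace (c • A) = c * ctrace A := by simp [ctrace_eq_sum, Finset.mul_sum]

theorem ctrace_smulRight (f : EuclideanSpace ℝ (Fin N) →L[ℝ] ℝ) (v : EuclideanSpace ℝ (Fin N)) :
    ctrace (f.smulRight v) = f v := LinearMap.trace_smulRight f.toLinearMap v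

theorem ctrace_id : ctrace (ContinuousLinearMap.id ℝ (EuclideanSpace ℝ (Fin N))) = N := by
  simp [ctrace_eq_sum]

theorem continuous_ctrace : Continuous
    (ctrace : (EuclideanSpace ℝ (Fin N) →L[ℝ] EuclideanSpace ℝ (Fin N)) → ℝ) := by
  have : (ctrace : (EuclideanSpace ℝ (Fin N) →L[ℝ] EuclideanSpace ℝ (Fin N)) → ℝ) =
      fun A => ∑ i, A (EuclideanSpace.single i 1) i := funext ctrace_eq_sum
  rw [this]
  fun_prop

/-- A bulk density `φ` on `Ω` and a boundary density `ψ` on `frontier Ω` are integrable and have equal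
integrals. The typical example is the divergence and the flux of a vector field. -/
structure IsFluxPair (Ω : Set (EuclideanSpace ℝ (Fin N))) (φ ψ : EuclideanSpace ℝ (Fin N) → ℝ) :
    Prop where
  integrableOn : IntegrableOn φ Ω
  integrable : Integrable ψ (surfaceMeasure Ω)
  integral_eq : ∫ x in Ω, φ x = ∫ x, ψ x ∂(surfaceMeasure Ω)

namespace IsFluxPair

variable {φ φ₁ φ₂ ψ ψ₁ ψ₂ : EuclideanSpace ℝ (Fin N) → ℝ}

theorem add (h₁ : IsFluxPair Ω φ₁ ψ₁) (h₂ : IsFluxPair Ω φ₂ ψ₂) :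
    IsFluxPair Ω (fun x => φ₁ x + φ₂ x) (fun x => ψ₁ x + ψ₂ x) :=
  ⟨h₁.1.add h₂.1, h₁.2.add h₂.2, by
    rw [integral_add h₁.1 h₂.1, integral_add h₁.2 h₂.2, h₁.3, h₂.3]⟩

theorem const_mul (h : IsFluxPair Ω φ ψ) (c : ℝ) :
    IsFluxPair Ω (fun x => c * φ x) (fun x => c * ψ x) :=
  ⟨h.1.const_mul c, h.2.const_mul c, by rw [integral_const_mul, integral_const_mul, h.3]⟩

theorem sub (h₁ : IsFluxPair Ω φ₁ ψ₁) (h₂ : IsFluxPair Ω φ₂ ψ₂) :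
    IsFluxPair Ω (fun x => φ₁ x - φ₂ x) (fun x => ψ₁ x - ψ₂ x) :=
  ⟨h₁.1.sub h₂.1, h₁.2.sub h₂.2, by
    rw [integral_sub h₁.1 h₂.1, integral_sub h₁.2 h₂.2, h₁.3, h₂.3]⟩

theorem congr (hΩ : IsOpen Ω) (h : IsFluxPair Ω φ₁ ψ₁) (hφ : ∀ x ∈ Ω, φ₁ x = φ₂ x)
    (hψ : ∀ x ∈ frontier Ω, ψ₁ x = ψ₂ x) : IsFluxPair Ω φ₂ ψ₂ :=
  ⟨h.1.congr_fun hφ hΩ.measurableSet,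
    IntegrableOn.congr_fun h.2 hψ isClosed_frontier.measurableSet, by
    rw [← setIntegral_congr_fun hΩ.measurableSet hφ, h.3]
    exact setIntegral_congr_fun isClosed_frontier.measurableSet hψ⟩

theorem sum {ι : Type*} (s : Finset ι) {φ ψ : ι → EuclideanSpace ℝ (Fin N) → ℝ}
    (h : ∀ i ∈ s, IsFluxPair Ω (φ i) (ψ i)) :
    IsFluxPair Ω (fun x => ∑ i ∈ s, φ i x) (fun x => ∑ i ∈ s, ψ i x) :=
  ⟨integrable_finsetSum s fun i hi => (h i hi).1, integrable_finsetSum s fun i hi => (h i hi).2, by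
    rw [integral_finsetSum s fun i hi => (h i hi).1, integral_finsetSum s fun i hi => (h i hi).2]
    exact Finset.sum_congr rfl fun i hi => (h i hi).3⟩

end IsFluxPair

/-- The Jacobian of a vector field up to the boundary of `Ω`, that is, its derivative relative to
`closure Ω`. -/
noncomputable abbrev jacobian (Ω : Set (EuclideanSpace ℝ (Fin N)))
    (X : EuclideanSpace ℝ (Fin N) → EuclideanSpace ℝ (Fin N)) (x : EuclideanSpace ℝ (Fin N)) :
    EuclideanSpace ℝ (Fin N) →L[ℝ] EuclideanSpace ℝ (Fin N) :=
  fderivWithin ℝ X (closure Ω) x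

theorem dirDeriv_single_coord (hu : UniqueDiffOn ℝ (closure Ω))
    {X : EuclideanSpace ℝ (Fin N) → EuclideanSpace ℝ (Fin N)} (hX : ContDiffOn ℝ 1 X (closure Ω))
    {x : EuclideanSpace ℝ (Fin N)} (hx : x ∈ closure Ω) (i j : Fin N) :
    dirDeriv Ω (EuclideanSpace.single i 1) (fun y => X y j) x =
      jacobian Ω X x (EuclideanSpace.single i 1) j := by
  have h1 := (hX.differentiableOn one_ne_zero x hx).hasFDerivWithinAt
  have h2 := (EuclideanSpace.proj j : EuclideanSpace ℝ (Fin N) →L[ℝ] ℝ).hasFDerivAt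
    (x := X x) |>.comp_hasFDerivWithinAt x h1
  have h3 : fderivWithin ℝ (fun y => X y j) (closure Ω) x = _ := h2.fderivWithin (hu x hx)
  rw [dirDeriv, h3]
  rfl

theorem clm_apply_eq_sum (A : EuclideanSpace ℝ (Fin N) →L[ℝ] EuclideanSpace ℝ (Fin N))
    (v : EuclideanSpace ℝ (Fin N)) : A v = ∑ i, v i • A (EuclideanSpace.single i 1) := by
  have h1 : v = ∑ i, v i • EuclideanSpace.single i (1 : ℝ) := by
    simpa using ((EuclideanSpace.basisFun (Fin N) ℝ).sum_repr v).symm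
  conv_lhs => rw [h1]
  simp only [map_sum, map_smul]

theorem sum_sum_coord_eq_ctrace_comp
    (A B : EuclideanSpace ℝ (Fin N) →L[ℝ] EuclideanSpace ℝ (Fin N)) :
    ∑ i, ∑ j, A (EuclideanSpace.single i 1) j * B (EuclideanSpace.single j 1) i =
      ctrace (A ∘L B) := by
  rw [ctrace_eq_sum, Finset.sum_comm]
  refine Finset.sum_congr rfl fun j _ => ?_
  rw [ContinuousLinearMap.comp_apply, clm_apply_eq_sum A]
  simp [mul_comm]

/-- **Flux identity for two vector fields**: the quadratic expression
`tr (DX DY) - tr DX tr DY` is the divergence of `(DY) X - (div Y) X`. Only first derivatives occur,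
and `X` and `Y` need only be `C¹` up to the boundary. -/
theorem isFluxPair_jacobian (hΩ : IsOpen Ω) (hbdd : Bornology.IsBounded Ω)
    (hC : HasC2Boundary Ω) (hN : 0 < N)
    {X Y : EuclideanSpace ℝ (Fin N) → EuclideanSpace ℝ (Fin N)} (hX : ContDiffOn ℝ 1 X (closure Ω))
    (hY : ContDiffOn ℝ 1 Y (closure Ω)) :
    IsFluxPair Ω
      (fun x => ctrace (jacobian Ω X x ∘L jacobian Ω Y x) -
        ctrace (jacobian Ω X x) * ctrace (jacobian Ω Y x))
      (fun x => ⟪jacobian Ω Y x (X x), extNormal Ω x⟫ -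
        ctrace (jacobian Ω Y x) * ⟪X x, extNormal Ω x⟫) := by
  have hu := hC.uniqueDiffOn_closure hΩ
  have hXj : ∀ j, ContDiffOn ℝ 1 (fun x => X x j) (closure Ω) := fun j => by fun_prop
  have hYj : ∀ j, ContDiffOn ℝ 1 (fun x => Y x j) (closure Ω) := fun j => by fun_prop
  have hpair : ∀ i j : Fin N, IsFluxPair Ω _ _ := fun i j =>
    ⟨integrableOn_of_continuousOn_closure hbdd (continuousOn_green_bulk hΩ hC (hXj j) (hYj i)
      (EuclideanSpace.single i 1) (EuclideanSpace.single j 1)),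
      hC.integrable_surfaceMeasure hΩ hbdd hN (continuousOn_green_boundary hΩ hC (hXj j) (hYj i)
      (EuclideanSpace.single i 1) (EuclideanSpace.single j 1)),
      integral_dirDeriv_mul_sub_eq hΩ hbdd hC hN (hXj j) (hYj i) _ _⟩
  refine (IsFluxPair.sum Finset.univ fun i _ => IsFluxPair.sum Finset.univ fun j _ =>
    hpair i j).congr hΩ (fun x hx => ?_) (fun x hx => ?_)
  · have e : ∀ i j, dirDeriv Ω (EuclideanSpace.single i 1) (fun x => X x j) x = _ :=
      fun i j => dirDeriv_single_coord hu hX (subset_closure hx) i j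
    have e' : ∀ i j, dirDeriv Ω (EuclideanSpace.single i 1) (fun x => Y x j) x = _ :=
      fun i j => dirDeriv_single_coord hu hY (subset_closure hx) i j
    simp only [e, e', Finset.sum_sub_distrib]
    rw [sum_sum_coord_eq_ctrace_comp, ctrace_eq_sum (jacobian Ω X x),
      ctrace_eq_sum (jacobian Ω Y x), Finset.sum_mul_sum, Finset.sum_comm]
  · have e' : ∀ i j, dirDeriv Ω (EuclideanSpace.single i 1) (fun x => Y x j) x = _ :=
      fun i j => dirDeriv_single_coord hu hY (frontier_subset_closure hx) i j
    have hX' : ⟪X x, extNormal Ω x⟫ = ∑ j, X x j * extNormal Ω x j := by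
      simp [PiLp.inner_apply, mul_comm]
    simp only [e', EuclideanSpace.inner_single_left, map_one, one_mul]
    rw [clm_apply_eq_sum, sum_inner, ctrace_eq_sum, hX', Finset.sum_mul_sum,
      Finset.sum_comm (γ := Fin N), ← Finset.sum_sub_distrib]
    conv_rhs => rw [Finset.sum_sub_distrib, Finset.sum_comm, ← Finset.sum_sub_distrib]
    refine Finset.sum_congr rfl fun j _ => ?_
    rw [inner_smul_left, PiLp.inner_apply, conj_trivial, Finset.mul_sum, ← Finset.sum_sub_distrib]
    refine Finset.sum_congr rfl fun i _ => ?_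
    simp only [RCLike.inner_apply, conj_trivial]
    ring

end FluxPairs

/-! ### Tangential derivatives and curvature -/

section BoundaryGeometry

variable {N : ℕ} {Ω : Set (EuclideanSpace ℝ (Fin N))}

/-- The exterior unit normal of a `C²` domain extends to a `C¹` vector field on the whole space,
which need not have length one away from the boundary. -/
theorem NeumannIdentity.HasC2Boundary.exists_contDiff_extension (hC : HasC2Boundary Ω)
    (hΩ : IsOpen Ω) : ∃ n : EuclideanSpace ℝ (Fin N) → EuclideanSpace ℝ (Fin N),
      ContDiff ℝ 1 n ∧ ∀ x ∈ frontier Ω, n x = extNormal Ω x := by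
  obtain ⟨g, hg⟩ := exists_contMDiffMap_forall_mem_convex_of_local (n := 1)
    (modelWithCornersSelf ℝ (EuclideanSpace ℝ (Fin N)))
    (t := fun x => {z | x ∈ frontier Ω → z = extNormal Ω x}) (F := EuclideanSpace ℝ (Fin N))
    (fun x => by
      by_cases hx : x ∈ frontier Ω
      · simp only [hx, forall_const]
        exact convex_singleton _
      · simp only [hx, false_imp_iff]
        exact convex_univ)
    (fun x => by
      by_cases hx : x ∈ frontier Ω
      · obtain ⟨φ, r, hr, hφ, -⟩ := hC.exists_isDefiningOn hx
        exact ⟨_, Metric.ball_mem_nhds x hr, unitGradient φ,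
          hφ.contDiffOn_unitGradient.contMDiffOn,
          fun y hy hyΓ => (hφ.extNormal_eq hΩ ⟨hyΓ, hy⟩).symm⟩
      · exact ⟨_, isClosed_frontier.isOpen_compl.mem_nhds hx, fun _ => 0, contMDiffOn_const,
          fun y hy hyΓ => absurd hyΓ hy⟩)
  exact ⟨g, g.contMDiff.contDiff, fun x hx => hg x hx⟩

/-- Every vector orthogonal to the normal is tangent to the boundary: the points obtained by tilting
it slightly outwards or inwards lie on different sides of the boundary. -/
theorem NeumannIdentity.IsExteriorUnitNormal.mem_tangentConeAt (hΩ : IsOpen Ω)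
    {x ν τ : EuclideanSpace ℝ (Fin N)} (h : IsExteriorUnitNormal Ω x ν) (hτ : ⟪ν, τ⟫ = 0) :
    τ ∈ tangentConeAt ℝ (frontier Ω) x := by
  have key : ∀ ε > 0, ∃ t ∈ Set.Ioo (0 : ℝ) ε, ∃ σ ∈ Set.Icc (-ε) ε,
      x + t • (τ + σ • ν) ∈ frontier Ω := by
    intro ε hε
    have hτ' : ⟪τ, ν⟫ = 0 := by rw [real_inner_comm, hτ]
    have h1 := h.2.1 (τ + (-ε) • ν) (by
      rw [inner_add_left, hτ', inner_smul_left, real_inner_self_eq_norm_sq, h.1]; simpa using hε)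
    have h2 := h.2.2 (τ + ε • ν) (by
      rw [inner_add_left, hτ', inner_smul_left, real_inner_self_eq_norm_sq, h.1]; simpa using hε)
    obtain ⟨t, ⟨ht1, ht2⟩, ht⟩ := ((h1.and h2).and (Ioo_mem_nhdsGT hε)).exists
    refine ⟨t, ht, ?_⟩
    have hpre : IsPreconnected ((fun σ : ℝ => x + t • (τ + σ • ν)) '' Set.Icc (-ε) ε) :=
      isPreconnected_Icc.image _ (by fun_prop)
    by_contra hno
    push Not at hno
    obtain ⟨z, -, hz1, hz2⟩ := hpre Ω (closure Ω)ᶜ hΩ isClosed_closure.isOpen_compl (by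
        rintro _ ⟨σ, hσ, rfl⟩
        by_contra hc
        rw [Set.mem_union, not_or, Set.notMem_compl_iff] at hc
        refine hno σ hσ ?_
        rw [hΩ.frontier_eq]
        exact ⟨hc.2, hc.1⟩)
      ⟨_, ⟨-ε, ⟨le_rfl, by linarith⟩, rfl⟩, ht1⟩ ⟨_, ⟨ε, ⟨by linarith, le_rfl⟩, rfl⟩, ht2⟩
    exact hz2 (subset_closure hz1)
  choose t ht σ hσ hmem using fun k : ℕ => key (1 / ((k : ℝ) + 1)) (by positivity)
  have h0 := tendsto_one_div_add_atTop_nhds_zero_nat (𝕜 := ℝ)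
  have ht0 : Tendsto t atTop (𝓝 0) := squeeze_zero (fun k => (ht k).1.le) (fun k => (ht k).2.le) h0
  have hσ0 : Tendsto σ atTop (𝓝 0) :=
    squeeze_zero_norm (fun k => abs_le.2 ⟨(hσ k).1, (hσ k).2⟩) h0
  have hlim : Tendsto (fun k => τ + σ k • ν) atTop (𝓝 τ) := by
    simpa using (hσ0.smul_const ν).const_add τ
  refine mem_tangentConeAt_of_seq atTop (fun k => (t k)⁻¹) (fun k => t k • (τ + σ k • ν)) ?_
    (Eventually.of_forall hmem) ?_
  · simpa using ht0.smul hlim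
  · refine hlim.congr fun k => ?_
    rw [smul_smul, inv_mul_cancel₀ (ht k).1.ne', one_smul]

/-- Two derivatives along the boundary agree on tangent vectors. -/
theorem hasFDerivWithinAt_frontier_unique {F : Type*} [NormedAddCommGroup F] [NormedSpace ℝ F]
    (hΩ : IsOpen Ω) {x ν τ : EuclideanSpace ℝ (Fin N)} (h : IsExteriorUnitNormal Ω x ν)
    (hτ : ⟪ν, τ⟫ = 0) {f : EuclideanSpace ℝ (Fin N) → F} {A B : EuclideanSpace ℝ (Fin N) →L[ℝ] F}
    (hA : HasFDerivWithinAt f A (frontier Ω) x) (hB : HasFDerivWithinAt f B (frontier Ω) x) :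
    A τ = B τ :=
  hA.unique_on hB (h.mem_tangentConeAt hΩ hτ)

section

variable {n : EuclideanSpace ℝ (Fin N) → EuclideanSpace ℝ (Fin N)} {x : EuclideanSpace ℝ (Fin N)}

theorem tangentProj_apply (w : EuclideanSpace ℝ (Fin N)) :
    tangentProj Ω x w = w - ⟪extNormal Ω x, w⟫ • extNormal Ω x := by
  simp [tangentProj]

theorem inner_extNormal_tangentProj (hν : ‖extNormal Ω x‖ = 1) (w : EuclideanSpace ℝ (Fin N)) :
    ⟪extNormal Ω x, tangentProj Ω x w⟫ = 0 := by
  rw [tangentProj_apply, inner_sub_right, inner_smul_right, real_inner_self_eq_norm_sq, hν]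
  ring

/-- The derivative of the unit normal in tangential directions is tangential. -/
theorem inner_extNormal_fderiv_eq_zero (hC : HasC2Boundary Ω) (hΩ : IsOpen Ω)
    (hn : ContDiff ℝ 1 n) (hnν : ∀ y ∈ frontier Ω, n y = extNormal Ω y) (hx : x ∈ frontier Ω)
    {τ : EuclideanSpace ℝ (Fin N)} (hτ : ⟪extNormal Ω x, τ⟫ = 0) :
    ⟪extNormal Ω x, fderiv ℝ n x τ⟫ = 0 := by
  have hn' := (hn.differentiable one_ne_zero x).hasFDerivAt.hasFDerivWithinAt (s := frontier Ω)
  have h1 := hn'.inner ℝ hn'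
  have h2 : HasFDerivWithinAt (fun y => ⟪n y, n y⟫) (0 : EuclideanSpace ℝ (Fin N) →L[ℝ] ℝ)
      (frontier Ω) x := by
    refine (hasFDerivWithinAt_const (1 : ℝ) x (frontier Ω)).congr (fun y hy => ?_) ?_
    · rw [hnν y hy, real_inner_self_eq_norm_sq, (hC.isExteriorUnitNormal hΩ hy).1, one_pow]
    · rw [hnν x hx, real_inner_self_eq_norm_sq, (hC.isExteriorUnitNormal hΩ hx).1, one_pow]
  have h3 := hasFDerivWithinAt_frontier_unique hΩ (hC.isExteriorUnitNormal hΩ hx) hτ h1 h2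
  have h4 : ⟪n x, fderiv ℝ n x τ⟫ + ⟪fderiv ℝ n x τ, n x⟫ = 0 := by simpa using h3
  rw [real_inner_comm (n x), hnν x hx] at h4
  linarith

/-- The intrinsic Jacobian `∇ν` in terms of any `C¹` extension of the normal. -/
theorem normalJacobian_eq (hC : HasC2Boundary Ω) (hΩ : IsOpen Ω)
    (hn : ContDiff ℝ 1 n) (hnν : ∀ y ∈ frontier Ω, n y = extNormal Ω y) (hx : x ∈ frontier Ω) :
    normalJacobian Ω x =
      fderiv ℝ n x - (innerSL ℝ (extNormal Ω x)).smulRight (fderiv ℝ n x (extNormal Ω x)) := by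
  have hext := hC.isExteriorUnitNormal hΩ hx
  refine ContinuousLinearMap.ext fun w => ?_
  have hτ := inner_extNormal_tangentProj hext.1 w
  have hn' := (hn.differentiable one_ne_zero x).hasFDerivAt.hasFDerivWithinAt (s := frontier Ω)
  have h1 : HasFDerivWithinAt (extNormal Ω) (fderiv ℝ n x) (frontier Ω) x :=
    hn'.congr (fun y hy => (hnν y hy).symm) (hnν x hx).symm
  have h2 := hasFDerivWithinAt_frontier_unique hΩ hext hτ
    h1.differentiableWithinAt.hasFDerivWithinAt h1
  have h3 := inner_extNormal_fderiv_eq_zero hC hΩ hn hnν hx hτ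
  rw [normalJacobian, ContinuousLinearMap.comp_apply, ContinuousLinearMap.comp_apply, h2,
    tangentProj_apply, h3, zero_smul, sub_zero, tangentProj_apply, map_sub, map_smul]
  simp

theorem meanCurvature_eq (hC : HasC2Boundary Ω) (hΩ : IsOpen Ω) (hN : 2 ≤ N)
    (hn : ContDiff ℝ 1 n) (hnν : ∀ y ∈ frontier Ω, n y = extNormal Ω y) (hx : x ∈ frontier Ω) :
    ((N : ℝ) - 1) * meanCurvature Ω x =
      ctrace (fderiv ℝ n x) - ⟪extNormal Ω x, fderiv ℝ n x (extNormal Ω x)⟫ := by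
  have hN' : (N : ℝ) - 1 ≠ 0 := by
    have : (2 : ℝ) ≤ N := by exact_mod_cast hN
    linarith
  rw [meanCurvature, mul_div_cancel₀ _ hN', normalJacobian_eq hC hΩ hn hnν hx]
  have := ctrace_sub (fderiv ℝ n x)
    ((innerSL ℝ (extNormal Ω x)).smulRight (fderiv ℝ n x (extNormal Ω x)))
  rw [ctrace_smulRight, innerSL_apply_apply] at this
  exact this

/-- Tangential derivative of a constant normal component: if `⟪G, ν⟫` is constant on the boundary,
then `⟪(DG) τ, ν⟫ + ⟪G, (Dν) τ⟫ = 0` for tangent vectors `τ`. -/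
theorem inner_jacobian_add_inner_eq_zero (hC : HasC2Boundary Ω) (hΩ : IsOpen Ω)
    (hn : ContDiff ℝ 1 n) (hnν : ∀ y ∈ frontier Ω, n y = extNormal Ω y) (hx : x ∈ frontier Ω)
    {G : EuclideanSpace ℝ (Fin N) → EuclideanSpace ℝ (Fin N)} (hG : ContDiffOn ℝ 1 G (closure Ω))
    {R : ℝ} (hR : ∀ y ∈ frontier Ω, ⟪G y, extNormal Ω y⟫ = R)
    {τ : EuclideanSpace ℝ (Fin N)} (hτ : ⟪extNormal Ω x, τ⟫ = 0) :
    ⟪jacobian Ω G x τ, extNormal Ω x⟫ + ⟪G x, fderiv ℝ n x τ⟫ = 0 := by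
  have hn' := (hn.differentiable one_ne_zero x).hasFDerivAt.hasFDerivWithinAt (s := frontier Ω)
  have hG' := (hG.differentiableOn one_ne_zero x (frontier_subset_closure hx)).hasFDerivWithinAt.mono
    (frontier_subset_closure (s := Ω))
  have h1 := hG'.inner ℝ hn'
  have h2 : HasFDerivWithinAt (fun y => ⟪G y, n y⟫) (0 : EuclideanSpace ℝ (Fin N) →L[ℝ] ℝ)
      (frontier Ω) x := by
    refine (hasFDerivWithinAt_const R x (frontier Ω)).congr (fun y hy => ?_) ?_
    · rw [hnν y hy, hR y hy]
    · rw [hnν x hx, hR x hx]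
  have h3 := hasFDerivWithinAt_frontier_unique hΩ (hC.isExteriorUnitNormal hΩ hx) hτ h1 h2
  have h4 : ⟪G x, fderiv ℝ n x τ⟫ + ⟪jacobian Ω G x τ, n x⟫ = 0 := by simpa using h3
  rw [hnν x hx] at h4
  linarith

end

end BoundaryGeometry

/-! ### Fluxes of products -/

section VectorFields

variable {N : ℕ} {Ω : Set (EuclideanSpace ℝ (Fin N))}
  {X Y : EuclideanSpace ℝ (Fin N) → EuclideanSpace ℝ (Fin N)}
  {JX JY : EuclideanSpace ℝ (Fin N) → EuclideanSpace ℝ (Fin N) →L[ℝ] EuclideanSpace ℝ (Fin N)}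

theorem ctrace_smulRight_comp (f : EuclideanSpace ℝ (Fin N) →L[ℝ] ℝ) (v : EuclideanSpace ℝ (Fin N))
    (B : EuclideanSpace ℝ (Fin N) →L[ℝ] EuclideanSpace ℝ (Fin N)) :
    ctrace (f.smulRight v ∘L B) = f (B v) :=
  ctrace_smulRight (f ∘L B) v

theorem ctrace_comp_comm (A B : EuclideanSpace ℝ (Fin N) →L[ℝ] EuclideanSpace ℝ (Fin N)) :
    ctrace (A ∘L B) = ctrace (B ∘L A) :=
  LinearMap.trace_mul_comm ℝ A.toLinearMap B.toLinearMap

/-- The flux identity, with prescribed Jacobians. -/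
theorem isFluxPair_of_hasFDerivWithinAt (hΩ : IsOpen Ω) (hbdd : Bornology.IsBounded Ω)
    (hC : HasC2Boundary Ω) (hN : 0 < N) (hX : ContDiffOn ℝ 1 X (closure Ω))
    (hY : ContDiffOn ℝ 1 Y (closure Ω))
    (hJX : ∀ x ∈ closure Ω, HasFDerivWithinAt X (JX x) (closure Ω) x)
    (hJY : ∀ x ∈ closure Ω, HasFDerivWithinAt Y (JY x) (closure Ω) x) :
    IsFluxPair Ω (fun x => ctrace (JX x ∘L JY x) - ctrace (JX x) * ctrace (JY x))
      (fun x => ⟪JY x (X x), extNormal Ω x⟫ - ctrace (JY x) * ⟪X x, extNormal Ω x⟫) := by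
  have hu := hC.uniqueDiffOn_closure hΩ
  have e1 : ∀ x ∈ closure Ω, jacobian Ω X x = JX x := fun x hx => (hJX x hx).fderivWithin (hu x hx)
  have e2 : ∀ x ∈ closure Ω, jacobian Ω Y x = JY x := fun x hx => (hJY x hx).fderivWithin (hu x hx)
  refine (isFluxPair_jacobian hΩ hbdd hC hN hX hY).congr hΩ (fun x hx => ?_) (fun x hx => ?_)
  · rw [e1 x (subset_closure hx), e2 x (subset_closure hx)]
  · rw [e2 x (frontier_subset_closure hx)]

/-- The bulk term of the flux identity is symmetric in the two fields. Hence the antisymmetric part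
of the flux has vanishing integral; this plays the role of integration by parts on the boundary. -/
theorem isFluxPair_antisymm (hΩ : IsOpen Ω) (hbdd : Bornology.IsBounded Ω)
    (hC : HasC2Boundary Ω) (hN : 0 < N) (hX : ContDiffOn ℝ 1 X (closure Ω))
    (hY : ContDiffOn ℝ 1 Y (closure Ω))
    (hJX : ∀ x ∈ closure Ω, HasFDerivWithinAt X (JX x) (closure Ω) x)
    (hJY : ∀ x ∈ closure Ω, HasFDerivWithinAt Y (JY x) (closure Ω) x) :
    IsFluxPair Ω (fun _ => 0)
      (fun x => ⟪JY x (X x), extNormal Ω x⟫ - ctrace (JY x) * ⟪X x, extNormal Ω x⟫ -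
        ⟪JX x (Y x), extNormal Ω x⟫ + ctrace (JX x) * ⟪Y x, extNormal Ω x⟫) := by
  refine ((isFluxPair_of_hasFDerivWithinAt hΩ hbdd hC hN hX hY hJX hJY).sub
    (isFluxPair_of_hasFDerivWithinAt hΩ hbdd hC hN hY hX hJY hJX)).congr hΩ
    (fun x hx => ?_) (fun x hx => ?_)
  · rw [ctrace_comp_comm]; ring
  · ring

/-- The **divergence theorem**, obtained from the flux identity for `X` and the identity field. -/
theorem isFluxPair_ctrace (hΩ : IsOpen Ω) (hbdd : Bornology.IsBounded Ω)
    (hC : HasC2Boundary Ω) (hN : 2 ≤ N) (hX : ContDiffOn ℝ 1 X (closure Ω))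
    (hJX : ∀ x ∈ closure Ω, HasFDerivWithinAt X (JX x) (closure Ω) x) :
    IsFluxPair Ω (fun x => ctrace (JX x)) (fun x => ⟪X x, extNormal Ω x⟫) := by
  have hN' : (1 : ℝ) - N ≠ 0 := by
    have : (2 : ℝ) ≤ N := by exact_mod_cast hN
    linarith
  have h := (isFluxPair_of_hasFDerivWithinAt hΩ hbdd hC (by omega) hX contDiffOn_id hJX
    fun x _ => (hasFDerivWithinAt_id x (closure Ω))).const_mul (1 - (N : ℝ))⁻¹
  refine h.congr hΩ (fun x hx => ?_) (fun x hx => ?_)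
  · rw [ContinuousLinearMap.comp_id, ctrace_id]
    field_simp
  · rw [ContinuousLinearMap.id_apply, ctrace_id]
    field_simp

/-- The divergence theorem for the product of a function and a vector field. -/
theorem isFluxPair_smul (hΩ : IsOpen Ω) (hbdd : Bornology.IsBounded Ω)
    (hC : HasC2Boundary Ω) (hN : 2 ≤ N) (hX : ContDiffOn ℝ 1 X (closure Ω))
    (hJX : ∀ x ∈ closure Ω, HasFDerivWithinAt X (JX x) (closure Ω) x)
    {φ : EuclideanSpace ℝ (Fin N) → ℝ} (hφ : ContDiffOn ℝ 1 φ (closure Ω))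
    {Dφ : EuclideanSpace ℝ (Fin N) → EuclideanSpace ℝ (Fin N) →L[ℝ] ℝ}
    (hDφ : ∀ x ∈ closure Ω, HasFDerivWithinAt φ (Dφ x) (closure Ω) x) :
    IsFluxPair Ω (fun x => φ x * ctrace (JX x) + Dφ x (X x))
      (fun x => φ x * ⟪X x, extNormal Ω x⟫) := by
  have hJ : ∀ x ∈ closure Ω, HasFDerivWithinAt (fun y => φ y • X y)
      (φ x • JX x + (Dφ x).smulRight (X x)) (closure Ω) x := fun x hx => (hDφ x hx).smul (hJX x hx)
  refine (isFluxPair_ctrace hΩ hbdd hC hN (hφ.smul hX) hJ).congr hΩ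
    (fun x hx => ?_) (fun x hx => ?_)
  · rw [ctrace_add, ctrace_smul, ctrace_smulRight]
  · exact real_inner_smul_left _ _ _

/-- The derivative of the inner product of two vector fields. -/
theorem hasFDerivWithinAt_inner {x : EuclideanSpace ℝ (Fin N)}
    {A B : EuclideanSpace ℝ (Fin N) →L[ℝ] EuclideanSpace ℝ (Fin N)}
    (hX : HasFDerivWithinAt X A (closure Ω) x) (hY : HasFDerivWithinAt Y B (closure Ω) x) :
    HasFDerivWithinAt (fun y => ⟪X y, Y y⟫)
      (innerSL ℝ (X x) ∘L B + innerSL ℝ (Y x) ∘L A) (closure Ω) x := by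
  refine (hX.inner ℝ hY).congr_fderiv (ContinuousLinearMap.ext fun v => ?_)
  simp [real_inner_comm]

end VectorFields

/-! ### The Hessian as the Jacobian of the gradient -/

section Hessian

variable {N : ℕ} {Ω : Set (EuclideanSpace ℝ (Fin N))} {v : EuclideanSpace ℝ (Fin N) → ℝ}

theorem contDiffOn_gradientWithin (hu : UniqueDiffOn ℝ (closure Ω))
    (hv : ContDiffOn ℝ 2 v (closure Ω)) :
    ContDiffOn ℝ 1 (gradientWithin v (closure Ω)) (closure Ω) := by
  have h1 : ContDiffOn ℝ 1 (fderivWithin ℝ v (closure Ω)) (closure Ω) :=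
    hv.fderivWithin hu (by norm_num)
  exact (InnerProductSpace.toDual ℝ
    (EuclideanSpace ℝ (Fin N))).symm.toContinuousLinearEquiv.contDiff.comp_contDiffOn h1

/-- In the interior, the Jacobian of the gradient is the second derivative. -/
theorem inner_jacobian_gradientWithin (hΩ : IsOpen Ω) (hv : ContDiffOn ℝ 2 v (closure Ω))
    {x : EuclideanSpace ℝ (Fin N)} (hx : x ∈ Ω) (a b : EuclideanSpace ℝ (Fin N)) :
    ⟪jacobian Ω (gradientWithin v (closure Ω)) x a, b⟫ = iteratedFDeriv ℝ 2 v x ![a, b] := by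
  have hcl : ∀ y ∈ Ω, closure Ω ∈ 𝓝 y := fun y hy =>
    mem_of_superset (hΩ.mem_nhds hy) subset_closure
  have hvx : ContDiffAt ℝ 2 v x := hv.contDiffAt (hcl x hx)
  have hev : gradientWithin v (closure Ω) =ᶠ[𝓝 x] gradient v := by
    filter_upwards [hΩ.mem_nhds hx] with y hy
    rw [gradientWithin, gradient, fderivWithin_of_mem_nhds (hcl y hy)]
  have h1 : HasFDerivAt (fderiv ℝ v) (fderiv ℝ (fderiv ℝ v) x) x :=
    ((hvx.fderiv_right (m := 1) (by norm_num)).differentiableAt one_ne_zero).hasFDerivAt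
  have h2 : HasFDerivAt (gradient v) _ x :=
    (InnerProductSpace.toDual ℝ (EuclideanSpace ℝ (Fin N))).symm.toContinuousLinearEquiv
      |>.toContinuousLinearMap.hasFDerivAt.comp x h1
  rw [jacobian, fderivWithin_of_mem_nhds (hcl x hx), hev.fderiv_eq, h2.fderiv,
    iteratedFDeriv_two_apply]
  exact InnerProductSpace.toDual_symm_apply

theorem inner_jacobian_gradientWithin_comm (hΩ : IsOpen Ω) (hv : ContDiffOn ℝ 2 v (closure Ω))
    {x : EuclideanSpace ℝ (Fin N)} (hx : x ∈ Ω) (a b : EuclideanSpace ℝ (Fin N)) :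
    ⟪jacobian Ω (gradientWithin v (closure Ω)) x a, b⟫ =
      ⟪jacobian Ω (gradientWithin v (closure Ω)) x b, a⟫ := by
  rw [inner_jacobian_gradientWithin hΩ hv hx, inner_jacobian_gradientWithin hΩ hv hx,
    iteratedFDeriv_two_apply, iteratedFDeriv_two_apply]
  have hvx : ContDiffAt ℝ 2 v x := hv.contDiffAt (mem_of_superset (hΩ.mem_nhds hx) subset_closure)
  exact hvx.isSymmSndFDerivAt (by simp) a b

theorem ctrace_jacobian_gradientWithin (hΩ : IsOpen Ω) (hv : ContDiffOn ℝ 2 v (closure Ω))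
    {x : EuclideanSpace ℝ (Fin N)} (hx : x ∈ Ω) :
    ctrace (jacobian Ω (gradientWithin v (closure Ω)) x) = Laplacian.laplacian v x := by
  rw [InnerProductSpace.laplacian_eq_iteratedFDeriv_orthonormalBasis v
    (EuclideanSpace.basisFun (Fin N) ℝ), ctrace_eq_sum]
  refine Finset.sum_congr rfl fun i _ => ?_
  rw [EuclideanSpace.basisFun_apply, ← inner_jacobian_gradientWithin hΩ hv hx,
    EuclideanSpace.inner_single_right]
  simp

theorem ctrace_jacobian_sq (hΩ : IsOpen Ω) (hv : ContDiffOn ℝ 2 v (closure Ω))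
    {x : EuclideanSpace ℝ (Fin N)} (hx : x ∈ Ω) :
    ctrace (jacobian Ω (gradientWithin v (closure Ω)) x ∘L
      jacobian Ω (gradientWithin v (closure Ω)) x) = hessianNormSq v x := by
  rw [← sum_sum_coord_eq_ctrace_comp, hessianNormSq]
  have hcoord : ∀ w : EuclideanSpace ℝ (Fin N), ∀ i, w i = ⟪w, EuclideanSpace.single i (1 : ℝ)⟫ :=
    fun w i => by rw [EuclideanSpace.inner_single_right]; simp
  refine Finset.sum_congr rfl fun i _ => Finset.sum_congr rfl fun j _ => ?_
  rw [hcoord _ j, hcoord _ i, inner_jacobian_gradientWithin_comm hΩ hv hx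
    (EuclideanSpace.single j 1), inner_jacobian_gradientWithin hΩ hv hx, sq]

end Hessian

/-! ### The combination of fluxes -/

section Main

variable {N : ℕ} {Ω : Set (EuclideanSpace ℝ (Fin N))}

/-- Here `G` is the gradient of a solution of `Δu = N`, with Jacobian `A`, the function `f` has
gradient `-G`, and `W` is the gradient of `h`; moreover `n` is an extension of the normal, with
Jacobian `B`. The boundary density contains `A` only through `⟪A (G - R ν), ν⟫`, and `G - R ν` is
tangential. -/
theorem isFluxPair_combination (hN : 2 ≤ N) (hΩ : IsOpen Ω) (hbdd : Bornology.IsBounded Ω)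
    (hC : HasC2Boundary Ω) {f : EuclideanSpace ℝ (Fin N) → ℝ}
    {G W n : EuclideanSpace ℝ (Fin N) → EuclideanSpace ℝ (Fin N)}
    {A B : EuclideanSpace ℝ (Fin N) → EuclideanSpace ℝ (Fin N) →L[ℝ] EuclideanSpace ℝ (Fin N)}
    {z : EuclideanSpace ℝ (Fin N)} {R : ℝ} (hf : ContDiffOn ℝ 1 f (closure Ω))
    (hG : ContDiffOn ℝ 1 G (closure Ω)) (hn : ContDiffOn ℝ 1 n (closure Ω))
    (hDf : ∀ x ∈ closure Ω, HasFDerivWithinAt f (-innerSL ℝ (G x)) (closure Ω) x)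
    (hDG : ∀ x ∈ closure Ω, HasFDerivWithinAt G (A x) (closure Ω) x)
    (hDn : ∀ x ∈ closure Ω, HasFDerivWithinAt n (B x) (closure Ω) x)
    (hsymm : ∀ x ∈ Ω, ∀ a b, ⟪A x a, b⟫ = ⟪A x b, a⟫)
    (htr : ∀ x ∈ closure Ω, ctrace (A x) = N)
    (hW : ∀ x, W x = x - z - G x)
    (hnν : ∀ x ∈ frontier Ω, n x = extNormal Ω x)
    (hR : ∀ x ∈ frontier Ω, ⟪G x, extNormal Ω x⟫ = R) :
    IsFluxPair Ω
      (fun x => f x * ctrace ((ContinuousLinearMap.id ℝ _ - A x) ∘L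
        (ContinuousLinearMap.id ℝ _ - A x)))
      (fun x => (1 / 2 * (⟪G x, G x⟫ - R ^ 2) - N * f x) * ⟪W x, extNormal Ω x⟫ +
        f x * (R * (ctrace (B x) * ⟪W x, extNormal Ω x⟫ - ⟪B x (W x), extNormal Ω x⟫) +
        (⟪A x (G x), extNormal Ω x⟫ - R * ⟪A x (extNormal Ω x), extNormal Ω x⟫))) := by
  have hN0 : 0 < N := by omega
  set Q : EuclideanSpace ℝ (Fin N) → EuclideanSpace ℝ (Fin N) := fun x => x - z with hQ
  set I := ContinuousLinearMap.id ℝ (EuclideanSpace ℝ (Fin N)) with hI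
  have hW' : W = fun x => Q x - G x := funext hW
  have hQc : ContDiffOn ℝ 1 Q (closure Ω) := by fun_prop
  have hDQ : ∀ x ∈ closure Ω, HasFDerivWithinAt Q I (closure Ω) x := fun x _ =>
    (hasFDerivWithinAt_id x (closure Ω)).sub_const z
  have hWc : ContDiffOn ℝ 1 W (closure Ω) := by rw [hW']; exact hQc.sub hG
  have hDW : ∀ x ∈ closure Ω, HasFDerivWithinAt W (I - A x) (closure Ω) x := fun x hx => by
    rw [hW']; exact (hDQ x hx).sub (hDG x hx)
  have htrW : ∀ x ∈ closure Ω, ctrace (I - A x) = 0 := fun x hx => by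
    rw [ctrace_sub, ctrace_id, htr x hx, sub_self]
  have hDfW : ∀ x ∈ closure Ω, HasFDerivWithinAt (fun y => f y • W y)
      (f x • (I - A x) + (-innerSL ℝ (G x)).smulRight (W x)) (closure Ω) x := fun x hx =>
    (hDf x hx).smul (hDW x hx)
  have hDfG : ∀ x ∈ closure Ω, HasFDerivWithinAt (fun y => f y • G y)
      (f x • A x + (-innerSL ℝ (G x)).smulRight (G x)) (closure Ω) x := fun x hx =>
    (hDf x hx).smul (hDG x hx)
  have hcl : ∀ x ∈ Ω, x ∈ closure Ω := fun x hx => subset_closure hx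
  have hfr : ∀ x ∈ frontier Ω, x ∈ closure Ω := fun x hx => frontier_subset_closure hx
  have p₁ : IsFluxPair Ω (fun x => f x * ctrace ((I - A x) ∘L (I - A x)) - ⟪G x, (I - A x) (W x)⟫)
      (fun x => f x * ⟪(I - A x) (W x), extNormal Ω x⟫) := by
    refine (isFluxPair_of_hasFDerivWithinAt hΩ hbdd hC hN0 (hf.smul hWc) hWc hDfW hDW).congr hΩ
      (fun x hx => ?_) (fun x hx => ?_)
    · rw [htrW x (hcl x hx), ContinuousLinearMap.add_comp, ctrace_add,
        ContinuousLinearMap.smul_comp, ctrace_smul, ctrace_smulRight_comp]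
      simp only [neg_apply, innerSL_apply_apply]
      ring
    · rw [htrW x (hfr x hx), Pi.smul_apply', map_smul, inner_smul_left, conj_trivial]
      ring
  -- The term `-⟪G, (DW) W⟫` in the bulk density of `p₁` is a divergence: since `DW` is symmetric and
  -- `G = Q - W`, adding `p₂`, `p₃` and `p₄` turns it into `|W|² = ⟪Q, W⟫ - ⟪G, W⟫`, and `p₅` and `p₆`
  -- absorb these two terms.
  have p₂ := isFluxPair_smul hΩ hbdd hC hN hG hDG (hWc.inner ℝ hWc)
    fun x hx => hasFDerivWithinAt_inner (hDW x hx) (hDW x hx)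
  have p₃ := isFluxPair_smul hΩ hbdd hC hN hQc hDQ (hWc.inner ℝ hWc)
    fun x hx => hasFDerivWithinAt_inner (hDW x hx) (hDW x hx)
  have p₄ := isFluxPair_smul hΩ hbdd hC hN hWc hDW (hQc.inner ℝ hWc)
    fun x hx => hasFDerivWithinAt_inner (hDQ x hx) (hDW x hx)
  have p₅ := isFluxPair_smul hΩ hbdd hC hN hWc hDW hf hDf
  have p₆ := isFluxPair_smul hΩ hbdd hC hN hWc hDW (hQc.inner ℝ hQc)
    fun x hx => hasFDerivWithinAt_inner (hDQ x hx) (hDQ x hx)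
  -- The bulk densities of the remaining fluxes vanish. Subtracting `p₈` removes `⟪A W, ν⟫` from the
  -- boundary density of `p₁`, and `p₉` introduces the Jacobian of the normal.
  have p₇ := isFluxPair_ctrace hΩ hbdd hC hN hWc hDW
  have p₈ := isFluxPair_antisymm hΩ hbdd hC hN0 (hf.smul hG) hWc hDfG hDW
  have p₉ := isFluxPair_antisymm hΩ hbdd hC hN0 (hf.smul hWc) hn hDfW hDn
  refine (((((((p₁.add (p₂.const_mul (1 / 2))).sub (p₃.const_mul (1 / 2))).add p₄).sub p₅).sub
    (p₆.const_mul (1 / 2))).add (p₇.const_mul (R ^ 2 / 2))).sub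
    (p₈.add (p₉.const_mul R))).congr hΩ (fun x hx => ?_) (fun x hx => ?_)
  · have hs := hsymm x hx
    have hGx : G x = Q x - W x := by rw [hW x]; simp [hQ]
    have h1 : ⟪W x, (I - A x) (G x)⟫ = ⟪G x, (I - A x) (W x)⟫ := by
      simp only [sub_apply, inner_sub_right, hI, ContinuousLinearMap.id_apply]
      rw [real_inner_comm (A x (G x)), real_inner_comm (A x (W x)), hs, real_inner_comm (W x)]
    have h2 : ⟪W x, (I - A x) (Q x)⟫ = ⟪Q x, (I - A x) (W x)⟫ := by
      simp only [sub_apply, inner_sub_right, hI, ContinuousLinearMap.id_apply]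
      rw [real_inner_comm (A x (Q x)), real_inner_comm (A x (W x)), hs, real_inner_comm (W x)]
    have h3 : ⟪G x, W x⟫ = ⟪Q x, W x⟫ - ⟪W x, W x⟫ := by rw [hGx, inner_sub_left]
    have hIv : ∀ v, I v = v := fun v => rfl
    simp only [htrW x (hcl x hx), htr x (hcl x hx), add_apply, neg_apply,
      ContinuousLinearMap.comp_apply, innerSL_apply_apply, hIv, h1, h2, h3]
    rw [hI, ctrace_id]
    ring
  · have hν := (hC.isExteriorUnitNormal hΩ hx).1
    have hQx : Q x = W x + G x := by rw [hW x]; simp [hQ]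
    have h1 : ⟪G x, W x⟫ = ⟪W x, G x⟫ := real_inner_comm _ _
    have hIv : ∀ v, I v = v := fun v => rfl
    simp only [htrW x (hfr x hx), hnν x hx, hQx, Pi.smul_apply', map_smul, ctrace_add, ctrace_smul,
      ctrace_smulRight, htr x (hfr x hx), add_apply, sub_apply, smul_apply, neg_apply,
      ContinuousLinearMap.smulRight_apply, innerSL_apply_apply, hIv, inner_add_left,
      inner_sub_left, inner_add_right, inner_smul_left, conj_trivial, hR x hx, h1,
      real_inner_self_eq_norm_sq, hν]
    ring

end Main

/-! ### The boundary density and the identity -/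

/-- On the boundary, the second order terms of `isFluxPair_combination` are curvature terms. The two
hypotheses on `A` and `B` come from the tangential derivatives of `|ν|² = 1` and `u_ν = R`. -/
theorem boundary_density_eq {V : Type*} [NormedAddCommGroup V] [InnerProductSpace ℝ V]
    {A B K : V →L[ℝ] V} {G W T ν : V} {R f c t : ℝ} (hν : ‖ν‖ = 1) (hG : ⟪G, ν⟫ = R)
    (hT : T = G - R • ν) (hB : ∀ τ, ⟪ν, τ⟫ = 0 → ⟪ν, B τ⟫ = 0)
    (hA : ∀ τ, ⟪ν, τ⟫ = 0 → ⟪A τ, ν⟫ + ⟪G, B τ⟫ = 0)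
    (hK : K = B - (innerSL ℝ ν).smulRight (B ν)) :
    (1 / 2 * (⟪G, G⟫ - R ^ 2) - c * f) * ⟪W, ν⟫ +
        f * (R * (t * ⟪W, ν⟫ - ⟪B W, ν⟫) + (⟪A G, ν⟫ - R * ⟪A ν, ν⟫)) =
      1 / 2 * (‖T‖ ^ 2 * ⟪W, ν⟫) + f * (R * (t - ⟪ν, B ν⟫) - c) * ⟪W, ν⟫ - f * ⟪K T, T⟫ := by
  have hνν : ⟪ν, ν⟫ = 1 := by rw [real_inner_self_eq_norm_sq, hν, one_pow]
  have hTν : ⟪ν, T⟫ = 0 := by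
    rw [hT, inner_sub_right, inner_smul_right, hνν, real_inner_comm, hG]; ring
  have hnorm : ‖T‖ ^ 2 = ⟪G, G⟫ - R ^ 2 := by
    rw [← real_inner_self_eq_norm_sq]
    nth_rw 1 [hT]
    rw [inner_sub_left, inner_smul_left, hTν, hT, inner_sub_right, inner_smul_right, hG]
    ring
  have hW : ⟪B W, ν⟫ = ⟪W, ν⟫ * ⟪ν, B ν⟫ := by
    have h := hB (W - ⟪W, ν⟫ • ν) (by
      rw [inner_sub_right, inner_smul_right, hνν, real_inner_comm]; ring)
    rw [map_sub, map_smul, inner_sub_right, inner_smul_right] at h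
    rw [real_inner_comm]; linarith
  have hAT : ⟪A G, ν⟫ - R * ⟪A ν, ν⟫ = -⟪B T, T⟫ := by
    have h := hA T hTν
    have hGT : ⟪G, B T⟫ = ⟪B T, T⟫ := by
      have : G = T + R • ν := by rw [hT]; abel
      rw [this, inner_add_left, inner_smul_left, hB T hTν, real_inner_comm]; simp
    have h2 : ⟪A T, ν⟫ = ⟪A G, ν⟫ - R * ⟪A ν, ν⟫ := by
      rw [hT, map_sub, map_smul, inner_sub_left, inner_smul_left, conj_trivial]
    linarith
  have hKT : ⟪K T, T⟫ = ⟪B T, T⟫ := by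
    simp [hK, hTν]
  rw [hnorm, hW, hAT, hKT]
  ring

theorem corollary3p3 (N : ℕ) (hN : 2 ≤ N) (Ω : Set (EuclideanSpace ℝ (Fin N)))
    (hΩ_open : IsOpen Ω) (hΩ_conn : IsConnected Ω) (hΩ_bdd : Bornology.IsBounded Ω)
    (hΩ_C2 : HasC2Boundary Ω)
    (u : EuclideanSpace ℝ (Fin N) → ℝ) (hu : ContDiffOn ℝ 2 u (closure Ω))
    (hΔu : ∀ x ∈ Ω, Laplacian.laplacian u x = N)
    (R : ℝ) (huν : ∀ x ∈ frontier Ω, normalDeriv Ω u x = R)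
    (ubar : ℝ) (hubar : IsGreatest (u '' closure Ω) ubar)
    (z : EuclideanSpace ℝ (Fin N)) (a : ℝ)
    (q h : EuclideanSpace ℝ (Fin N) → ℝ)
    (hq : ∀ x, q x = 1 / 2 * ‖x - z‖ ^ 2 + a) (hh : ∀ x, h x = q x - u x) :
    IntegrableOn (fun x => (ubar - u x) * hessianNormSq h x) Ω volume ∧
    Integrable (fun x => ‖tangentialGradient Ω u x‖ ^ 2 * normalDeriv Ω h x) (surfaceMeasure Ω) ∧
    Integrable (fun x => (ubar - u x) * (((N : ℝ) - 1) * R * meanCurvature Ω x - N) *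
      normalDeriv Ω h x) (surfaceMeasure Ω) ∧
    Integrable (fun x => (ubar - u x) *
      ⟪normalJacobian Ω x (tangentialGradient Ω u x), tangentialGradient Ω u x⟫)
      (surfaceMeasure Ω) ∧
    ∫ x in Ω, (ubar - u x) * hessianNormSq h x =
      1 / 2 * (∫ x, ‖tangentialGradient Ω u x‖ ^ 2 * normalDeriv Ω h x ∂(surfaceMeasure Ω))
      + (∫ x, (ubar - u x) * (((N : ℝ) - 1) * R * meanCurvature Ω x - N) *
          normalDeriv Ω h x ∂(surfaceMeasure Ω))
      - (∫ x, (ubar - u x) *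
          ⟪normalJacobian Ω x (tangentialGradient Ω u x), tangentialGradient Ω u x⟫
          ∂(surfaceMeasure Ω)) := by
  have hN0 : 0 < N := by omega
  have hU := hΩ_C2.uniqueDiffOn_closure hΩ_open
  obtain ⟨n, hn, hnν⟩ := hΩ_C2.exists_contDiff_extension hΩ_open
  have hcl : ∀ x ∈ Ω, x ∈ closure Ω := fun x hx => subset_closure hx
  have hfr : ∀ x ∈ frontier Ω, x ∈ closure Ω := fun x hx => frontier_subset_closure hx
  set G := gradientWithin u (closure Ω) with hGdef
  set A := jacobian Ω G with hAdef
  set W : EuclideanSpace ℝ (Fin N) → EuclideanSpace ℝ (Fin N) := fun x => x - z - G x with hWdef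
  set f : EuclideanSpace ℝ (Fin N) → ℝ := fun x => ubar - u x with hfdef
  have hG : ContDiffOn ℝ 1 G (closure Ω) := contDiffOn_gradientWithin hU hu
  have hDu : ∀ x ∈ closure Ω, HasFDerivWithinAt u (innerSL ℝ (G x)) (closure Ω) x := fun x hx =>
    (hu.differentiableOn two_ne_zero x hx).hasGradientWithinAt.hasFDerivWithinAt
  have hf : ContDiffOn ℝ 1 f (closure Ω) := contDiffOn_const.sub (hu.of_le one_le_two)
  have hDf : ∀ x ∈ closure Ω, HasFDerivWithinAt f (-innerSL ℝ (G x)) (closure Ω) x := fun x hx =>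
    (hDu x hx).const_sub ubar
  have hDG : ∀ x ∈ closure Ω, HasFDerivWithinAt G (A x) (closure Ω) x := fun x hx =>
    (hG.differentiableOn one_ne_zero x hx).hasFDerivWithinAt
  have hDn : ∀ x ∈ closure Ω, HasFDerivWithinAt n (fderiv ℝ n x) (closure Ω) x := fun x _ =>
    (hn.differentiable one_ne_zero x).hasFDerivAt.hasFDerivWithinAt
  have hAc : ContinuousOn A (closure Ω) := hG.continuousOn_fderivWithin hU le_rfl
  -- The equation `Δu = N` extends to the closure by continuity.
  have htr : ∀ x ∈ closure Ω, ctrace (A x) = N := by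
    have h1 : Set.EqOn (fun x => ctrace (A x)) (fun _ => (N : ℝ)) Ω := fun x hx => by
      rw [← hΔu x hx]; exact ctrace_jacobian_gradientWithin hΩ_open hu hx
    exact fun x hx => h1.of_subset_closure (continuous_ctrace.comp_continuousOn hAc)
      continuousOn_const subset_closure subset_rfl hx
  have hR : ∀ x ∈ frontier Ω, ⟪G x, extNormal Ω x⟫ = R := huν
  have hh2 : ContDiffOn ℝ 2 h (closure Ω) := by
    have : ContDiff ℝ 2 fun x : EuclideanSpace ℝ (Fin N) => 1 / 2 * ‖x - z‖ ^ 2 + a :=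
      (contDiff_const.mul ((contDiff_id.sub contDiff_const).norm_sq ℝ)).add contDiff_const
    exact (this.contDiffOn.sub hu).congr fun x _ => by rw [hh, hq]
  have hgradh : ∀ x ∈ closure Ω, gradientWithin h (closure Ω) x = W x := fun x hx => by
    have h1 : HasFDerivWithinAt h (innerSL ℝ (W x)) (closure Ω) x := by
      have h2 := ((((hasFDerivWithinAt_id x (closure Ω)).sub_const z).norm_sq.const_mul
        (1 / 2 : ℝ)).add_const a).sub (hDu x hx)
      have h3 := h2.congr (f₁ := h) (fun y _ => by rw [hh, hq]; rfl) (by rw [hh, hq]; rfl)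
      refine h3.congr_fderiv (ContinuousLinearMap.ext fun w => ?_)
      simp [hWdef]
    rw [gradientWithin, h1.fderivWithin (hU x hx)]
    exact (InnerProductSpace.toDual ℝ _).symm_apply_apply (W x)
  have hnh : ∀ x ∈ frontier Ω, normalDeriv Ω h x = ⟪W x, extNormal Ω x⟫ := fun x hx => by
    rw [normalDeriv, hgradh x (hfr x hx)]
  have hhess : ∀ x ∈ Ω, hessianNormSq h x = ctrace ((ContinuousLinearMap.id ℝ _ - A x) ∘L
      (ContinuousLinearMap.id ℝ _ - A x)) := fun x hx => by
    have h1 : jacobian Ω (gradientWithin h (closure Ω)) x =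
        ContinuousLinearMap.id ℝ _ - A x := by
      have h2 : HasFDerivWithinAt W (ContinuousLinearMap.id ℝ _ - A x) (closure Ω) x :=
        ((hasFDerivWithinAt_id x (closure Ω)).sub_const z).sub (hDG x (hcl x hx))
      exact (h2.congr hgradh (hgradh x (hcl x hx))).fderivWithin (hU x (hcl x hx))
    rw [← ctrace_jacobian_sq hΩ_open hh2 hx, h1]
  have hT : ∀ x ∈ frontier Ω, tangentialGradient Ω u x = G x - R • extNormal Ω x := fun x hx => by
    rw [tangentialGradient, huν x hx]
  have hK := fun x (hx : x ∈ frontier Ω) => normalJacobian_eq hΩ_C2 hΩ_open hn hnν hx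
  have hH := fun x (hx : x ∈ frontier Ω) => meanCurvature_eq hΩ_C2 hΩ_open hN hn hnν hx
  have hpair := (isFluxPair_combination hN hΩ_open hΩ_bdd hΩ_C2 hf hG hn.contDiffOn hDf hDG hDn
    (fun x hx => inner_jacobian_gradientWithin_comm hΩ_open hu hx) htr (fun _ => rfl) hnν hR).congr
    hΩ_open (φ₂ := fun x => (ubar - u x) * hessianNormSq h x)
    (ψ₂ := fun x => 1 / 2 * (‖tangentialGradient Ω u x‖ ^ 2 * normalDeriv Ω h x) +
      (ubar - u x) * (((N : ℝ) - 1) * R * meanCurvature Ω x - N) * normalDeriv Ω h x -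
      (ubar - u x) * ⟪normalJacobian Ω x (tangentialGradient Ω u x), tangentialGradient Ω u x⟫)
    (fun x hx => by rw [hhess x hx]) (fun x hx => by
      rw [mul_right_comm _ R, hH x hx, mul_comm _ R, hnh x hx]
      exact boundary_density_eq (hΩ_C2.isExteriorUnitNormal hΩ_open hx).1 (hR x hx) (hT x hx)
        (fun τ hτ => inner_extNormal_fderiv_eq_zero hΩ_C2 hΩ_open hn hnν hx hτ)
        (fun τ hτ => inner_jacobian_add_inner_eq_zero hΩ_C2 hΩ_open hn hnν hx hG hR hτ) (hK x hx))
  have cν := hΩ_C2.continuousOn_extNormal hΩ_open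
  have cu : ContinuousOn u (frontier Ω) := hu.continuousOn.mono frontier_subset_closure
  have cG : ContinuousOn G (frontier Ω) := hG.continuousOn.mono frontier_subset_closure
  have cB : ContinuousOn (fderiv ℝ n) (frontier Ω) :=
    (hn.continuous_fderiv one_ne_zero).continuousOn
  have cT : ContinuousOn (tangentialGradient Ω u) (frontier Ω) :=
    (cG.sub (cν.const_smul R)).congr hT
  have ch : ContinuousOn (normalDeriv Ω h) (frontier Ω) :=
    (((continuousOn_id.sub continuousOn_const).sub cG).inner (𝕜 := ℝ) cν).congr hnh
  have cKT : ContinuousOn (fun x => normalJacobian Ω x (tangentialGradient Ω u x))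
      (frontier Ω) := by
    refine ((cB.clm_apply cT).sub ((cν.inner (𝕜 := ℝ) cT).smul (cB.clm_apply cν))).congr fun x hx => ?_
    rw [hK x hx]
    rfl
  have cH : ContinuousOn (fun x => ((N : ℝ) - 1) * R * meanCurvature Ω x) (frontier Ω) := by
    refine (((continuous_ctrace.comp_continuousOn cB).sub
      (cν.inner (𝕜 := ℝ) (cB.clm_apply cν))).const_smul R).congr fun x hx => ?_
    rw [mul_right_comm, hH x hx, mul_comm]
    rfl
  have i₁ : Integrable (fun x => ‖tangentialGradient Ω u x‖ ^ 2 * normalDeriv Ω h x)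
      (surfaceMeasure Ω) :=
    hΩ_C2.integrable_surfaceMeasure hΩ_open hΩ_bdd hN0 ((cT.norm.pow 2).mul ch)
  have i₂ : Integrable (fun x => (ubar - u x) * (((N : ℝ) - 1) * R * meanCurvature Ω x - N) *
      normalDeriv Ω h x) (surfaceMeasure Ω) :=
    hΩ_C2.integrable_surfaceMeasure hΩ_open hΩ_bdd hN0
      (((continuousOn_const.sub cu).mul (cH.sub continuousOn_const)).mul ch)
  have i₃ : Integrable (fun x => (ubar - u x) *
      ⟪normalJacobian Ω x (tangentialGradient Ω u x), tangentialGradient Ω u x⟫)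
      (surfaceMeasure Ω) :=
    hΩ_C2.integrable_surfaceMeasure hΩ_open hΩ_bdd hN0
      ((continuousOn_const.sub cu).mul (cKT.inner (𝕜 := ℝ) cT))
  refine ⟨hpair.integrableOn, i₁, i₂, i₃, ?_⟩
  rw [hpair.integral_eq]
  refine (integral_sub ((i₁.const_mul (1 / 2)).add i₂) i₃).trans ?_
  rw [integral_add' (i₁.const_mul (1 / 2)) i₂, integral_const_mul]
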